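/- **Conventions.** All algebras are unital, associative and over $\mathbb{C}$; complete locally convex spaces are Hausdorff. A *$\hat\otimes$-algebra* is an algebra on a complete locally convex space with jointly continuous multiplication. An *Arens–Michael algebra* is an algebra on a complete locally convex space whose topology is defined by a family of submultiplicative seminorms. An *$A$-$\hat\otimes$-bimodule* over a $\hat\otimes$-algebra $A$ is a complete locally convex space with an $A$-bimodule structure whose left and right actions are jointly continuous. For $A$-$\hat\otimes$-bimodules $M,N$, $M\hat\otimes_A N$ is the completed projective tensor product over $A$, i.e. the completion of the quotient of $M\hat\otimes N$ by the closed linear span of all $ma\otimes n-m\otimes an$, with the actions $a(m\otimes n)b=am\otimes nb$. Two $A$-$\hat\otimes$-bimodules $M,N$ are *topologically inverse* if there are topological $A$-bimodule isomorphisms $i_1:M\hat\otimes_A N\to A$ and $i_2:N\hat\otimes_A M\to A$ with $$i_1(m\otimes n)\,m'=m\,i_2(n\otimes m'),\qquad i_2(n\otimes m)\,n'=n\,i_1(m\otimes n')\qquad(m,m'\in M,\ n,n'\in N).$$ The *Arens–Michael envelope* of a $\hat\otimes$-algebra $A$ is an Arens–Michael algebra $\widehat A$ with a continuous homomorphism $i_A:A\to\widehat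 A$ such that every continuous homomorphism from $A$ to an Arens–Michael algebra factors as $\psi\circ i_A$ for a unique continuous homomorphism $\psi$. The *Arens–Michael envelope* of an $A$-$\hat\otimes$-bimodule $M$ is an $\widehat A$-$\hat\otimes$-bimodule $\widehat M$ with a continuous $A$-bimodule map $i_M:M\to\widehat M$ such that every continuous $A$-bimodule map from $M$ to an $\widehat A$-$\hat\otimes$-bimodule factors as $g\circ i_M$ for a unique continuous $\widehat A$-bimodule map $g$. Here $\widehat A$-bimodules are $A$-bimodules via $i_A$. **Theorem 2.1.** Let $A$ be a $\hat\otimes$-algebra and let $M$, $M^{-1}$ be topologically inverse $A$-$\hat\otimes$-bimodules. Suppose that 1. $i_A:A\to\widehat A$ is an epimorphism in the category of $\hat\otimes$-algebras (equivalently, the multiplication $\widehat A\hat\otimes_A\widehat A\to\widehat A$, $x\otimes y\mapsto xy$, is a topological isomorphism of $\widehat A$-bimodules); 2. $M\hat\otimes_A\widehat A\simeq\widehat A\hat\otimes_A M$ and $M^{-1}\hat\otimes_A\widehat A\simeq\widehat A\hat\otimes_A M^{-1}$ as topological $A$-bimodules. Then the Arens–Michael envelopes $\widehat M$ and $\widehat{M^{-1}}$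 are topologically inverse $\widehat A$-$\hat\otimes$-bimodules. -/

import Mathlib

open scoped TensorProduct
open MulOpposite (op)

universe u

set_option linter.unusedSectionVars false

/-! ### Complete locally convex spaces and topological algebras -/

/-- A complete (Hausdorff) locally convex space over `ℂ`: the topology is given by the continuous
seminorms. The uniformity is the one of the underlying topological additive group. -/
class CompleteLCS (E : Type*) [AddCommGroup E] [Module ℂ E] [UniformSpace E] : Prop
    extends IsUniformAddGroup E, ContinuousSMul ℂ E, PolynormableSpace ℂ E,
      CompleteSpace E, T2Space E

/-- A `⊗̂`-algebra: a unital associative complex algebra on a complete locally convex space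
with jointly continuous multiplication. -/
class TensorHatAlgebra (A : Type*) [Ring A] [Algebra ℂ A] [UniformSpace A] : Prop
    extends CompleteLCS A, ContinuousMul A

/-- An Arens–Michael algebra: a complete locally convex algebra whose topology is given by a
family of submultiplicative seminorms. -/
class ArensMichaelAlgebra (A : Type*) [Ring A] [Algebra ℂ A] [UniformSpace A] : Prop
    extends CompleteLCS A where
  exists_submultiplicative : ∃ P : Set (Seminorm ℂ A),
    (∀ p ∈ P, ∀ x y : A, p (x * y) ≤ p x * p y) ∧
      WithSeminorms (fun p : P => (p : Seminorm ℂ A))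

/-- Every Arens–Michael algebra is a `⊗̂`-algebra. -/
instance ArensMichaelAlgebra.toTensorHatAlgebra (A : Type*) [Ring A] [Algebra ℂ A]
    [UniformSpace A] [ArensMichaelAlgebra A] : TensorHatAlgebra A where
  continuous_mul := by
    obtain ⟨P, hsub, hP⟩ := ArensMichaelAlgebra.exists_submultiplicative (A := A)
    rw [continuous_iff_continuousAt]
    rintro ⟨a, b⟩
    refine (hP.tendsto_nhds _ _).2 fun p ε hε => ?_
    have hc : Continuous (p : Seminorm ℂ A) := hP.continuous_seminorm p
    have hg : Continuous fun x : A × A =>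
        (p : Seminorm ℂ A) (x.1 - a) * (p : Seminorm ℂ A) x.2 +
          (p : Seminorm ℂ A) a * (p : Seminorm ℂ A) (x.2 - b) := by fun_prop
    have h0 := hg.tendsto (a, b)
    simp only [sub_self, map_zero, zero_mul, mul_zero, add_zero] at h0
    filter_upwards [h0.eventually_lt_const hε] with x hx
    refine lt_of_le_of_lt ?_ hx
    have : x.1 * x.2 - a * b = (x.1 - a) * x.2 + a * (x.2 - b) := by noncomm_ring
    rw [this]
    exact (map_add_le_add _ _ _).trans
      (add_le_add (hsub p p.2 _ _) (hsub p p.2 _ _))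

/-! ### Bimodules -/

/-- An `A`-`⊗̂`-bimodule: a complete locally convex space with an `A`-bimodule structure whose
left and right actions are jointly continuous. Right multiplication `m · a` is `op a • m`. -/
class TensorHatBimodule (A M : Type*) [Ring A] [Algebra ℂ A] [UniformSpace A]
    [AddCommGroup M] [Module ℂ M] [UniformSpace M] [CompleteLCS M]
    [Module A M] [Module Aᵐᵒᵖ M] : Prop where
  isScalarTower_left : IsScalarTower ℂ A M
  isScalarTower_right : IsScalarTower ℂ Aᵐᵒᵖ M
  smulCommClass : SMulCommClass A Aᵐᵒᵖ M
  continuousSMul_left : ContinuousSMul A M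
  continuousSMul_right : ContinuousSMul Aᵐᵒᵖ M

attribute [instance] TensorHatBimodule.isScalarTower_left TensorHatBimodule.isScalarTower_right
  TensorHatBimodule.smulCommClass TensorHatBimodule.continuousSMul_left
  TensorHatBimodule.continuousSMul_right

/-- A `⊗̂`-algebra is a `⊗̂`-bimodule over itself. -/
instance TensorHatBimodule.self (A : Type*) [Ring A] [Algebra ℂ A] [UniformSpace A]
    [TensorHatAlgebra A] : TensorHatBimodule A A where
  isScalarTower_left := inferInstance
  isScalarTower_right := inferInstance
  smulCommClass := inferInstance
  continuousSMul_left := inferInstance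
  continuousSMul_right := inferInstance

/-- A map `f` from an `A`-bimodule to a `B`-bimodule respects both actions along `i : A → B`. -/
def IsBimoduleMapAlong {A B M N : Type*} [Ring A] [Ring B] [AddCommGroup M] [AddCommGroup N]
    [Module A M] [Module Aᵐᵒᵖ M] [Module B N] [Module Bᵐᵒᵖ N] (i : A → B) (f : M → N) : Prop :=
  (∀ (a : A) (m : M), f (a • m) = i a • f m) ∧
    ∀ (a : A) (m : M), f (op a • m) = op (i a) • f m

/-- A map of `A`-bimodules respects both actions. -/
def IsBimoduleMap (A : Type*) {M N : Type*} [Ring A] [AddCommGroup M] [AddCommGroup N]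
    [Module A M] [Module Aᵐᵒᵖ M] [Module A N] [Module Aᵐᵒᵖ N] (f : M → N) : Prop :=
  IsBimoduleMapAlong (id : A → A) f

/-- `M` and `N` are isomorphic as topological `A`-bimodules. -/
def TopBimoduleIso (A M N : Type*) [Ring A]
    [AddCommGroup M] [Module ℂ M] [TopologicalSpace M] [Module A M] [Module Aᵐᵒᵖ M]
    [AddCommGroup N] [Module ℂ N] [TopologicalSpace N] [Module A N] [Module Aᵐᵒᵖ N] : Prop :=
  ∃ e : M ≃L[ℂ] N, IsBimoduleMap A e

/-! ### Restriction of scalars of a bimodule along an algebra homomorphism -/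

section AlongHom

variable {A B : Type*} [Ring A] [Algebra ℂ A] [UniformSpace A]
  [Ring B] [Algebra ℂ B] [UniformSpace B]

/-- The `B`-bimodule `N`, regarded as an `A`-bimodule along `i : A → B`:
`a · n = i a · n` and `n · a = n · i a`. -/
def AlongHom (_ : A →A[ℂ] B) (N : Type*) : Type _ := N

variable (i : A →A[ℂ] B) (N : Type*) [AddCommGroup N]

instance : AddCommGroup (AlongHom i N) := inferInstanceAs (AddCommGroup N)

instance [Module ℂ N] : Module ℂ (AlongHom i N) := inferInstanceAs (Module ℂ N)

instance [UniformSpace N] : UniformSpace (AlongHom i N) := inferInstanceAs (UniformSpace N)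

instance [Module ℂ N] [UniformSpace N] [CompleteLCS N] : CompleteLCS (AlongHom i N) :=
  inferInstanceAs (CompleteLCS N)

instance [Module B N] : Module A (AlongHom i N) :=
  Module.compHom N ((i : A →ₐ[ℂ] B) : A →+* B)

instance [Module Bᵐᵒᵖ N] : Module Aᵐᵒᵖ (AlongHom i N) :=
  Module.compHom N (RingHom.op ((i : A →ₐ[ℂ] B) : A →+* B))

/-- The identity map from `N` to `N` regarded as an `A`-bimodule. -/
def AlongHom.of (n : N) : AlongHom i N := n

theorem AlongHom.smul_def [Module B N] (a : A) (n : N) : a • of i N n = of i N (i a • n) := rfl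

theorem AlongHom.op_smul_def [Module Bᵐᵒᵖ N] (a : A) (n : N) :
    op a • of i N n = of i N (op (i a) • n) := rfl

instance [Module ℂ N] [UniformSpace N] [CompleteLCS N] [Module B N] [Module Bᵐᵒᵖ N]
    [TensorHatBimodule B N] : TensorHatBimodule A (AlongHom i N) where
  isScalarTower_left := ⟨fun z a (n : N) => by
    change i (z • a) • (n : N) = z • (i a • (n : N))
    rw [map_smul, smul_assoc]⟩
  isScalarTower_right := ⟨fun z a (n : N) => by
    change op (i (z • a.unop)) • (n : N) = z • (op (i a.unop) • (n : N))
    rw [map_smul, MulOpposite.op_smul, smul_assoc]⟩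
  smulCommClass := ⟨fun a b (n : N) => by
    change i a • (op (i b.unop) • (n : N)) = op (i b.unop) • (i a • (n : N))
    rw [smul_comm]⟩
  continuousSMul_left := ⟨by
    change Continuous fun x : A × N => i x.1 • x.2
    have := i.continuous
    fun_prop⟩
  continuousSMul_right := ⟨by
    change Continuous fun x : Aᵐᵒᵖ × N => op (i x.1.unop) • x.2
    have := i.continuous
    fun_prop⟩

end AlongHom

/-! ### The completed projective tensor product over an algebra -/

section Tensor

variable (A M N : Type*) [Ring A]
  [AddCommGroup M] [Module ℂ M] [Module Aᵐᵒᵖ M] [AddCommGroup N] [Module ℂ N] [Module A N]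

/-- The span of the elements `m a ⊗ n - m ⊗ a n`. -/
def balancedRel : Submodule ℂ (M ⊗[ℂ] N) :=
  Submodule.span ℂ {t | ∃ (m : M) (a : A) (n : N), t = (op a • m) ⊗ₜ[ℂ] n - m ⊗ₜ[ℂ] (a • n)}

/-- The algebraic tensor product `M ⊗_A N`. -/
def AlgTensor : Type _ := (M ⊗[ℂ] N) ⧸ balancedRel A M N

noncomputable instance : AddCommGroup (AlgTensor A M N) :=
  inferInstanceAs (AddCommGroup ((M ⊗[ℂ] N) ⧸ balancedRel A M N))

noncomputable instance : Module ℂ (AlgTensor A M N) :=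
  inferInstanceAs (Module ℂ ((M ⊗[ℂ] N) ⧸ balancedRel A M N))

variable {M N}

/-- The elementary tensor `m ⊗ n` in `M ⊗_A N`. -/
noncomputable def AlgTensor.tmul (m : M) (n : N) : AlgTensor A M N :=
  (balancedRel A M N).mkQ (m ⊗ₜ[ℂ] n)

@[simp] theorem AlgTensor.zero_tmul (n : N) : tmul A (0 : M) n = 0 := by
  rw [tmul, TensorProduct.zero_tmul, map_zero]; rfl

@[simp] theorem AlgTensor.tmul_zero (m : M) : tmul A m (0 : N) = 0 := by
  rw [tmul, TensorProduct.tmul_zero, map_zero]; rfl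

@[simp] theorem AlgTensor.add_tmul (m m' : M) (n : N) :
    tmul A (m + m') n = tmul A m n + tmul A m' n := by
  rw [tmul, TensorProduct.add_tmul, map_add]; rfl

@[simp] theorem AlgTensor.tmul_add (m : M) (n n' : N) :
    tmul A m (n + n') = tmul A m n + tmul A m n' := by
  rw [tmul, TensorProduct.tmul_add, map_add]; rfl

variable (M N)

theorem AlgTensor.hom_ext {X : Type*} [AddCommGroup X] [Module ℂ X]
    {f g : AlgTensor A M N →ₗ[ℂ] X}
    (h : ∀ (m : M) (n : N), f (tmul A m n) = g (tmul A m n)) : f = g :=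
  Submodule.linearMap_qext _ (TensorProduct.ext' h)

section Topology

variable [TopologicalSpace M] [TopologicalSpace N]

/-- The seminorms on `M ⊗_A N` that define the projective topology: all those whose composition
with `(m, n) ↦ m ⊗ n` is (jointly) continuous. -/
noncomputable def AlgTensor.seminorms : SeminormFamily ℂ (AlgTensor A M N)
    {p : Seminorm ℂ (AlgTensor A M N) // Continuous fun x : M × N => p (tmul A x.1 x.2)} :=
  Subtype.val

instance : Nonempty {p : Seminorm ℂ (AlgTensor A M N) //
    Continuous fun x : M × N => p (AlgTensor.tmul A x.1 x.2)} :=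
  ⟨⟨0, continuous_const⟩⟩

/-- The projective topology on `M ⊗_A N`: the finest locally convex topology for which
`(m, n) ↦ m ⊗ n` is jointly continuous. -/
noncomputable instance : TopologicalSpace (AlgTensor A M N) :=
  (AlgTensor.seminorms A M N).moduleFilterBasis.topology

theorem AlgTensor.withSeminorms : WithSeminorms (AlgTensor.seminorms A M N) := ⟨rfl⟩

instance : IsTopologicalAddGroup (AlgTensor A M N) :=
  (AlgTensor.withSeminorms A M N).topologicalAddGroup

instance : ContinuousSMul ℂ (AlgTensor A M N) :=
  (AlgTensor.withSeminorms A M N).continuousSMul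

noncomputable instance : UniformSpace (AlgTensor A M N) :=
  IsTopologicalAddGroup.rightUniformSpace (AlgTensor A M N)

instance : IsUniformAddGroup (AlgTensor A M N) := isUniformAddGroup_of_addCommGroup

instance : UniformContinuousConstSMul ℂ (AlgTensor A M N) :=
  uniformContinuousConstSMul_of_continuousConstSMul ℂ (AlgTensor A M N)

/-- A linear endomorphism that carries elementary tensors to elementary tensors by continuous maps
of the factors is continuous for the projective topology. -/
theorem AlgTensor.continuous_of_tmul (f : AlgTensor A M N →ₗ[ℂ] AlgTensor A M N)
    {g : M → M} {h : N → N} (hg : Continuous g) (hh : Continuous h)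
    (hf : ∀ (m : M) (n : N), f (tmul A m n) = tmul A (g m) (h n)) : Continuous f := by
  refine WithSeminorms.continuous_of_isBounded (withSeminorms A M N) (withSeminorms A M N) f fun p => ?_
  have hp : Continuous fun x : M × N => (p.1.comp f) (tmul A x.1 x.2) := by
    have : (fun x : M × N => (p.1.comp f) (tmul A x.1 x.2)) =
        (fun x : M × N => p.1 (tmul A x.1 x.2)) ∘ fun x : M × N => (g x.1, h x.2) := by
      funext x
      simp [hf]
    rw [this]
    exact p.2.comp (by fun_prop)
  refine ⟨{⟨p.1.comp f, hp⟩}, 1, ?_⟩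
  simp only [Finset.sup_singleton, one_smul]
  exact le_refl _

/-- The completed projective tensor product `M ⊗̂_A N`: the (Hausdorff) completion of `M ⊗_A N`
with its projective topology; equivalently, the completion of the quotient of `M ⊗̂ N` by the closed
linear span of all `m a ⊗ n - m ⊗ a n`. -/
abbrev TensorHat : Type _ := UniformSpace.Completion (AlgTensor A M N)

variable {M N}

/-- The elementary tensor `m ⊗ n` in `M ⊗̂_A N`. -/
noncomputable def TensorHat.tmul (m : M) (n : N) : TensorHat A M N :=
  ((AlgTensor.tmul A m n : AlgTensor A M N) : UniformSpace.Completion (AlgTensor A M N))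

end Topology

end Tensor

/-! ### The bimodule structure `a · (m ⊗ n) · b = a m ⊗ n b` on `M ⊗̂_A N` -/

section TensorBimodule

variable (A M N : Type*) [Ring A] [Algebra ℂ A] [UniformSpace A]
  [AddCommGroup M] [Module ℂ M] [UniformSpace M] [CompleteLCS M]
  [Module A M] [Module Aᵐᵒᵖ M] [TensorHatBimodule A M]
  [AddCommGroup N] [Module ℂ N] [UniformSpace N] [CompleteLCS N]
  [Module A N] [Module Aᵐᵒᵖ N] [TensorHatBimodule A N]

/-- `m ⊗ n ↦ a m ⊗ n` on `M ⊗_A N`. -/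
noncomputable def AlgTensor.leftMul (a : A) : AlgTensor A M N →ₗ[ℂ] AlgTensor A M N :=
  (balancedRel A M N).mapQ (balancedRel A M N) ((Algebra.lsmul ℂ ℂ M a).rTensor N) (by
    refine Submodule.span_le.2 ?_
    rintro _ ⟨m, b, n, rfl⟩
    refine Submodule.subset_span ⟨a • m, b, n, ?_⟩
    simp [smul_comm a (op b) m])

/-- `m ⊗ n ↦ m ⊗ n b` on `M ⊗_A N`, where `b` is given as an element of the opposite algebra. -/
noncomputable def AlgTensor.rightMul (b : Aᵐᵒᵖ) : AlgTensor A M N →ₗ[ℂ] AlgTensor A M N :=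
  (balancedRel A M N).mapQ (balancedRel A M N) ((Algebra.lsmul ℂ ℂ N b).lTensor M) (by
    refine Submodule.span_le.2 ?_
    rintro _ ⟨m, a, n, rfl⟩
    refine Submodule.subset_span ⟨m, a, b • n, ?_⟩
    simp [smul_comm a b n])

theorem AlgTensor.leftMul_tmul (a : A) (m : M) (n : N) :
    leftMul A M N a (tmul A m n) = tmul A (a • m) n := rfl

theorem AlgTensor.rightMul_tmul (b : Aᵐᵒᵖ) (m : M) (n : N) :
    rightMul A M N b (tmul A m n) = tmul A m (b • n) := rfl

noncomputable instance : Module A (AlgTensor A M N) :=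
  Module.compHom (R := Module.End ℂ (AlgTensor A M N)) (AlgTensor A M N)
    { toFun := AlgTensor.leftMul A M N
      map_one' := AlgTensor.hom_ext A M N fun m n => by simp [AlgTensor.leftMul_tmul]
      map_mul' := fun a b => AlgTensor.hom_ext A M N fun m n => by
        simp [AlgTensor.leftMul_tmul, mul_smul]
      map_zero' := AlgTensor.hom_ext A M N fun m n => by
        simp [AlgTensor.leftMul_tmul]
      map_add' := fun a b => AlgTensor.hom_ext A M N fun m n => by
        simp [AlgTensor.leftMul_tmul, add_smul] }

noncomputable instance : Module Aᵐᵒᵖ (AlgTensor A M N) :=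
  Module.compHom (R := Module.End ℂ (AlgTensor A M N)) (AlgTensor A M N)
    { toFun := AlgTensor.rightMul A M N
      map_one' := AlgTensor.hom_ext A M N fun m n => by simp [AlgTensor.rightMul_tmul]
      map_mul' := fun a b => AlgTensor.hom_ext A M N fun m n => by
        simp [AlgTensor.rightMul_tmul, mul_smul]
      map_zero' := AlgTensor.hom_ext A M N fun m n => by
        simp [AlgTensor.rightMul_tmul]
      map_add' := fun a b => AlgTensor.hom_ext A M N fun m n => by
        simp [AlgTensor.rightMul_tmul, add_smul] }

/-! By continuity the two actions extend to the completion `TensorHat A M N`. -/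
instance : UniformContinuousConstSMul A (AlgTensor A M N) :=
  ⟨fun a => uniformContinuous_addMonoidHom_of_continuous
    (f := (AlgTensor.leftMul A M N a).toAddMonoidHom)
    (AlgTensor.continuous_of_tmul A M N (AlgTensor.leftMul A M N a) (g := fun m => a • m)
      (h := fun n => n) (by fun_prop) (by fun_prop) fun _ _ => rfl)⟩

instance : UniformContinuousConstSMul Aᵐᵒᵖ (AlgTensor A M N) :=
  ⟨fun b => uniformContinuous_addMonoidHom_of_continuous
    (f := (AlgTensor.rightMul A M N b).toAddMonoidHom)
    (AlgTensor.continuous_of_tmul A M N (AlgTensor.rightMul A M N b) (g := fun m => m)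
      (h := fun n => b • n) (by fun_prop) (by fun_prop) fun _ _ => rfl)⟩

variable {M N}

theorem TensorHat.smul_tmul (a : A) (m : M) (n : N) :
    a • TensorHat.tmul A m n = TensorHat.tmul A (a • m) n :=
  (UniformSpace.Completion.coe_smul a (AlgTensor.tmul A m n)).symm

theorem TensorHat.op_smul_tmul (a : A) (m : M) (n : N) :
    op a • TensorHat.tmul A m n = TensorHat.tmul A m (op a • n) :=
  (UniformSpace.Completion.coe_smul (op a) (AlgTensor.tmul A m n)).symm

end TensorBimodule

/-! ### Topologically inverse bimodules -/

/-- `M` and `N` are topologically inverse `A`-`⊗̂`-bimodules: there are topological bimodule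
isomorphisms `i₁ : M ⊗̂_A N ≃ A` and `i₂ : N ⊗̂_A M ≃ A` such that the associativity squares
`M ⊗̂_A N ⊗̂_A M → M` and `N ⊗̂_A M ⊗̂_A N → N` commute. All maps in these squares are linear and
continuous, so the squares are written on the elementary tensors `m ⊗ n ⊗ m'` and `n ⊗ m ⊗ n'`,
which span dense subspaces. -/
def AreTopInverse (A M N : Type*) [Ring A] [Algebra ℂ A] [UniformSpace A]
    [AddCommGroup M] [Module ℂ M] [UniformSpace M] [CompleteLCS M]
    [Module A M] [Module Aᵐᵒᵖ M] [TensorHatBimodule A M]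
    [AddCommGroup N] [Module ℂ N] [UniformSpace N] [CompleteLCS N]
    [Module A N] [Module Aᵐᵒᵖ N] [TensorHatBimodule A N] : Prop :=
  ∃ (i₁ : TensorHat A M N ≃L[ℂ] A) (i₂ : TensorHat A N M ≃L[ℂ] A),
    IsBimoduleMap A i₁ ∧ IsBimoduleMap A i₂ ∧
    (∀ (m : M) (n : N) (m' : M),
      i₁ (TensorHat.tmul A m n) • m' = op (i₂ (TensorHat.tmul A n m')) • m) ∧
    (∀ (n : N) (m : M) (n' : N),
      i₂ (TensorHat.tmul A n m) • n' = op (i₁ (TensorHat.tmul A m n')) • n)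

/-! ### Arens–Michael envelopes of topological algebras and bimodules -/

section Envelopes

variable {A AH : Type u} [Ring A] [Algebra ℂ A] [UniformSpace A]
  [Ring AH] [Algebra ℂ AH] [UniformSpace AH]

/-- `(AH, i)` is the Arens–Michael envelope of the topological algebra `A`: every continuous
homomorphism from `A` to an Arens–Michael algebra extends uniquely along `i`. -/
def IsArensMichaelEnvelope [ArensMichaelAlgebra AH] (i : A →A[ℂ] AH) : Prop :=
  ∀ (B : Type u) [Ring B] [Algebra ℂ B] [UniformSpace B] [ArensMichaelAlgebra B]
    (φ : A →A[ℂ] B), ∃! ψ : AH →A[ℂ] B, ∀ a : A, ψ (i a) = φ a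

/-- `(MH, j)` is the Arens–Michael envelope of the topological `A`-bimodule `M`, where `i : A → AH`
is the Arens–Michael envelope of `A`: `j` is a continuous `A`-bimodule map to an `AH`-`⊗̂`-bimodule,
and every continuous `A`-bimodule map from `M` to an `AH`-`⊗̂`-bimodule extends uniquely along `j` to
a continuous `AH`-bimodule map. -/
def IsBimoduleArensMichaelEnvelope (i : A →A[ℂ] AH) {M MH : Type u}
    [AddCommGroup M] [Module ℂ M] [UniformSpace M] [Module A M] [Module Aᵐᵒᵖ M]
    [AddCommGroup MH] [Module ℂ MH] [UniformSpace MH] [CompleteLCS MH]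
    [Module AH MH] [Module AHᵐᵒᵖ MH] [TensorHatBimodule AH MH] (j : M →L[ℂ] MH) : Prop :=
  IsBimoduleMapAlong i j ∧
  ∀ (N : Type u) [AddCommGroup N] [Module ℂ N] [UniformSpace N] [CompleteLCS N]
    [Module AH N] [Module AHᵐᵒᵖ N] [TensorHatBimodule AH N] (f : M →L[ℂ] N),
    IsBimoduleMapAlong i f →
      ∃! g : MH →L[ℂ] N, IsBimoduleMap AH g ∧ ∀ m : M, g (j m) = f m

/-- `i` is an epimorphism in the category of `⊗̂`-algebras and continuous homomorphisms. -/
def IsTensorHatEpi (i : A →A[ℂ] AH) : Prop :=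
  ∀ (B : Type u) [Ring B] [Algebra ℂ B] [UniformSpace B] [TensorHatAlgebra B]
    (f g : AH →A[ℂ] B), (∀ a : A, f (i a) = g (i a)) → f = g

/-- The multiplication `AH ⊗̂_A AH → AH`, `x ⊗ y ↦ x y`, is a topological isomorphism. (It is
automatically `AH`-linear on both sides.) -/
def MulIsTopIso [TensorHatAlgebra AH] (i : A →A[ℂ] AH) : Prop :=
  ∃ μ : TensorHat A (AlongHom i AH) (AlongHom i AH) ≃L[ℂ] AH,
    ∀ x y : AH, μ (TensorHat.tmul A (AlongHom.of i AH x) (AlongHom.of i AH y)) = x * y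

end Envelopes

/-! Write `B` for the enveloping algebra. The epimorphism condition says that `b ⊗ 1 = 1 ⊗ b` in `B
⊗̂_A B`. It is obtained by comparing two homomorphisms into a trivial square-zero extension of `B`,
which differ by an inner derivation vanishing on the image of `A` (`IsTensorHatEpi.central`).
Consequently a continuous `A`-linear map between `B`-modules is automatically `B`-linear
(`IsTensorHatEpi.map_smul`, `IsTensorHatEpi.map_op_smul`).

The second hypothesis then identifies the envelope of `M`. The space `B ⊗̂_A M` has a left
`B`-action, and the isomorphism with `M ⊗̂_A B` carries a right `B`-action over to it. The two
actions commute by automatic linearity, so `B ⊗̂_A M` is a bimodule with the universal property of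
the envelope (`IsBimoduleArensMichaelEnvelope.exists_equiv`).

Heuristically, the tensor product of the envelopes over `B` is `B ⊗̂_A M ⊗̂_A N ≃ B ⊗̂_A A ≃ B`. The
proof avoids iterated tensor products. It extends the `A`-valued pairing of `M` and `N` to a
`B`-valued pairing of the envelopes, one variable at a time (`exists_pairing`). The inverse is `b ↦
b • e`, where `e` is the image of the element of `M ⊗̂_A N` that corresponds to `1`
(`exists_pairing_equiv`). The associativity squares hold on the images of `M` and `N`, and spread to
the envelopes by linearity and density (`pairing_assoc`).

The analytic input is `TensorHat.continuous_uncurry`: joint continuity on a completed tensor product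
can be tested on elementary tensors. It supplies the joint continuity of the module actions and of
the pairings. -/

open Filter Topology UniformSpace

/-! ### Completions of locally convex spaces -/

section Completion

variable {E : Type*} [AddCommGroup E] [Module ℂ E] [UniformSpace E] [IsUniformAddGroup E]
  [UniformContinuousConstSMul ℂ E]

/-- The extension of a continuous seminorm to the completion. -/
noncomputable def Seminorm.completion (p : Seminorm ℂ E) (hp : Continuous p) :
    Seminorm ℂ (Completion E) :=
  have hu : UniformContinuous p := Seminorm.uniformContinuous_of_continuousAt_zero hp.continuousAt
  have hc : Continuous (Completion.extension p) := Completion.continuous_extension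
  Seminorm.of (Completion.extension p)
    (fun x y => Completion.induction_on₂ x y
      (isClosed_le (hc.comp continuous_add)
        ((hc.comp continuous_fst).add (hc.comp continuous_snd))) fun a b => by
        rw [← Completion.coe_add, Completion.extension_coe hu, Completion.extension_coe hu,
          Completion.extension_coe hu]
        exact map_add_le_add p a b)
    (fun z x => Completion.induction_on x
      (isClosed_eq (hc.comp (continuous_const_smul z)) (continuous_const.mul hc)) fun a => by
        rw [← Completion.coe_smul, Completion.extension_coe hu, Completion.extension_coe hu,
          map_smul_eq_mul])

theorem Seminorm.completion_coe (p : Seminorm ℂ E) (hp : Continuous p) (x : E) :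
    p.completion hp (x : Completion E) = p x :=
  Completion.extension_coe (Seminorm.uniformContinuous_of_continuousAt_zero hp.continuousAt) x

theorem Seminorm.continuous_completion (p : Seminorm ℂ E) (hp : Continuous p) :
    Continuous (p.completion hp) :=
  Completion.continuous_extension

/-- Every neighbourhood of zero contains a closed one. That one meets `E` in a set containing a ball
of some continuous seminorm `p`, and by density the open ball of the extension of `p` lies in the
closure of the `p`-ball of `E`. -/
theorem PolynormableSpace.completion [PolynormableSpace ℂ E] :
    PolynormableSpace ℂ (Completion E) where
  withSeminorms' := by
    rw [SeminormFamily.withSeminorms_iff_nhds_eq_iInf]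
    refine le_antisymm ?_ ?_
    · simp_rw [le_iInf_iff, ← tendsto_iff_comap]
      intro ⟨p, hp⟩
      exact hp.tendsto' 0 0 (map_zero _)
    · intro U hU
      obtain ⟨U', hU', hcl, hsub⟩ := exists_mem_nhds_isClosed_subset hU
      have hpre : ((↑) : E → Completion E) ⁻¹' U' ∈ 𝓝 (0 : E) :=
        (Completion.continuous_coe E).continuousAt.preimage_mem_nhds
          (by rwa [Completion.coe_zero])
      obtain ⟨s, r, hr, hs⟩ :=
        ((PolynormableSpace.withSeminorms ℂ E).mem_nhds_iff 0 _).1 hpre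
      set p : Seminorm ℂ E :=
        s.sup (fun p : {p : Seminorm ℂ E // Continuous p} => p.1) with hpdef
      have hp : Continuous p := Seminorm.continuous_finsetSup fun q _ => q.2
      have hball : p.completion hp ⁻¹' Metric.ball 0 r ⊆ U := by
        have hopen : IsOpen (p.completion hp ⁻¹' Metric.ball 0 r) :=
          Metric.isOpen_ball.preimage (p.continuous_completion hp)
        intro x hx
        refine hsub (hcl.closure_subset_iff.2 ?_
          (Completion.denseRange_coe.open_subset_closure_inter hopen hx))
        rintro _ ⟨hy, y, rfl⟩
        refine hs ?_
        rw [Seminorm.mem_ball_zero]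
        have := mem_ball_zero_iff.1 (Set.mem_preimage.1 hy)
        rw [Seminorm.completion_coe] at this
        exact (le_abs_self _).trans_lt this
      refine mem_of_superset (mem_iInf_of_mem (⟨p.completion hp, p.continuous_completion hp⟩ :
        {p : Seminorm ℂ (Completion E) // Continuous p}) ?_) hball
      exact preimage_mem_comap (Metric.ball_mem_nhds 0 hr)

variable {F : Type*} [AddCommGroup F] [Module ℂ F] [UniformSpace F] [CompleteLCS F]

/-- The extension of a continuous linear map to the completion. -/
noncomputable def LinearMap.extendCompletion (f : E →ₗ[ℂ] F) (hf : Continuous f) :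
    Completion E →L[ℂ] F :=
  have hf' : Continuous f.toAddMonoidHom := hf
  { toFun := f.toAddMonoidHom.extension hf'
    map_add' := map_add _
    map_smul' := fun z t => Completion.induction_on t
      (isClosed_eq ((AddMonoidHom.continuous_extension _ hf').comp (continuous_const_smul z))
        ((AddMonoidHom.continuous_extension _ hf').const_smul z)) fun s => by
          rw [← Completion.coe_smul, AddMonoidHom.extension_coe, AddMonoidHom.extension_coe]
          exact map_smul f z s
    cont := AddMonoidHom.continuous_extension _ hf' }

theorem LinearMap.extendCompletion_coe (f : E →ₗ[ℂ] F) (hf : Continuous f) (x : E) :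
    f.extendCompletion hf x = f x :=
  AddMonoidHom.extension_coe f.toAddMonoidHom hf x

theorem CompleteLCS.completion [PolynormableSpace ℂ E] : CompleteLCS (Completion E) :=
  have := PolynormableSpace.completion (E := E)
  have : ContinuousSMul ℂ (Completion E) :=
    (PolynormableSpace.withSeminorms ℂ (Completion E)).continuousSMul
  { }

end Completion

/-! ### Continuity of bilinear maps -/

theorem Seminorm.tendsto_zero_of_forall_eventually_le {X T : Type*} [AddCommGroup T] [Module ℂ T]
    (q : Seminorm ℂ T) (f : X → T) (l : Filter X) (h : ∀ ε > 0, ∀ᶠ y in l, q (f y) ≤ ε) :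
    letI := q.toSeminormedAddCommGroup
    Tendsto f l (𝓝 0) := by
  let _ := q.toSeminormedAddCommGroup
  rw [Metric.nhds_basis_closedBall.tendsto_right_iff]
  intro ε hε
  filter_upwards [h ε hε] with y hy
  rw [mem_closedBall_zero_iff]
  exact hy

/-- Neighbourhoods of zero are absorbing. The scalar is taken nonzero so that the rescaling can be
undone. -/
theorem exists_ne_zero_smul_mem {E : Type*} [AddCommGroup E] [Module ℂ E] [TopologicalSpace E]
    [ContinuousSMul ℂ E] (x : E) {V : Set E} (hV : V ∈ 𝓝 (0 : E)) : ∃ k : ℂ, k ≠ 0 ∧ k • x ∈ V := by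
  have ht : Tendsto (fun k : ℂ => k • x) (𝓝[≠] 0) (𝓝 0) :=
    (Continuous.tendsto' (by fun_prop) _ _ (by simp)).mono_left nhdsWithin_le_nhds
  obtain ⟨k, hk, hk0⟩ := ((ht.eventually hV).and self_mem_nhdsWithin).exists
  exact ⟨k, hk0, hk⟩

/-- Homogeneity turns the bound `1` near zero into any bound `ε`, and absorption gives continuity at
zero in each variable with the other fixed. For a biadditive map these three facts imply continuity
everywhere. -/
theorem Seminorm.continuous_bilinear {M N T : Type*} [AddCommGroup M] [Module ℂ M]
    [TopologicalSpace M] [IsTopologicalAddGroup M] [ContinuousSMul ℂ M]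
    [AddCommGroup N] [Module ℂ N] [TopologicalSpace N] [IsTopologicalAddGroup N]
    [ContinuousSMul ℂ N] [AddCommGroup T] [Module ℂ T] (q : Seminorm ℂ T)
    (b : M →ₗ[ℂ] N →ₗ[ℂ] T) (h : ∀ᶠ x in 𝓝 (0 : M × N), q (b x.1 x.2) ≤ 1) :
    Continuous fun x : M × N => q (b x.1 x.2) := by
  have key : ∀ ε > 0, ∀ᶠ x in 𝓝 (0 : M × N), q (b x.1 x.2) ≤ ε := by
    intro ε hε
    -- Rescaling only one factor by `ε⁻¹` multiplies the value by exactly `ε⁻¹`.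
    have ht : Tendsto (fun x : M × N => (((ε⁻¹ : ℝ) : ℂ) • x.1, x.2)) (𝓝 0) (𝓝 0) :=
      Continuous.tendsto' (by fun_prop) _ _ (by simp)
    filter_upwards [ht.eventually h] with x hx
    simp only [map_smul, LinearMap.smul_apply, map_smul_eq_mul, Complex.norm_real, norm_inv,
      Real.norm_eq_abs, abs_of_pos hε] at hx
    rwa [inv_mul_le_iff₀ hε, mul_one] at hx
  -- `T` has no topology of its own; it receives the one for which `q` is the norm.
  let _ : SeminormedAddCommGroup T := q.toSeminormedAddCommGroup
  let f : M →+ N →+ T :=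
    { toFun := fun m => (b m).toAddMonoidHom
      map_zero' := by ext; simp
      map_add' := fun x y => by ext; simp }
  refine (continuous_norm (E := T)).comp (continuous_of_continuousAt_zero₂ f ?_ ?_ ?_)
  · have h0 : f (0 : M × N).1 (0 : M × N).2 = 0 := by simp
    change Tendsto _ _ (𝓝 (f (0 : M × N).1 (0 : M × N).2))
    rw [h0]
    exact q.tendsto_zero_of_forall_eventually_le _ _ key
  · intro x
    rw [ContinuousAt, map_zero]
    refine q.tendsto_zero_of_forall_eventually_le _ _ fun ε hε => ?_
    obtain ⟨V, hV, W, hW, hVW⟩ := mem_nhds_prod_iff.1 (key ε hε)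
    obtain ⟨k, hk0, hk⟩ := exists_ne_zero_smul_mem x hV
    have ht : Tendsto (fun n : N => k⁻¹ • n) (𝓝 0) (𝓝 0) :=
      Continuous.tendsto' (by fun_prop) _ _ (by simp)
    filter_upwards [ht.eventually hW] with n hn
    have := hVW (Set.mk_mem_prod hk hn)
    simpa [f, smul_smul, hk0] using this
  · intro y
    rw [ContinuousAt, map_zero]
    refine q.tendsto_zero_of_forall_eventually_le _ _ fun ε hε => ?_
    obtain ⟨V, hV, W, hW, hVW⟩ := mem_nhds_prod_iff.1 (key ε hε)
    obtain ⟨k, hk0, hk⟩ := exists_ne_zero_smul_mem y hW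
    have ht : Tendsto (fun m : M => k⁻¹ • m) (𝓝 0) (𝓝 0) :=
      Continuous.tendsto' (by fun_prop) _ _ (by simp)
    filter_upwards [ht.eventually hV] with m hm
    have := hVW (Set.mk_mem_prod hm hk)
    simpa [f, smul_smul, hk0] using this

/-! ### The universal property of the completed projective tensor product -/

section UniversalProperty

variable {A M N X : Type*} [Ring A]
  [AddCommGroup M] [Module ℂ M] [Module Aᵐᵒᵖ M] [AddCommGroup N] [Module ℂ N] [Module A N]
  [AddCommGroup X] [Module ℂ X]

/-- The linear map on `M ⊗_A N` given by a balanced bilinear map. -/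
noncomputable def AlgTensor.lift (b : M →ₗ[ℂ] N →ₗ[ℂ] X)
    (hb : ∀ m (a : A) n, b (op a • m) n = b m (a • n)) : AlgTensor A M N →ₗ[ℂ] X :=
  (balancedRel A M N).liftQ (TensorProduct.lift b) (by
    refine Submodule.span_le.2 ?_
    rintro _ ⟨m, a, n, rfl⟩
    simp [hb])

@[simp] theorem AlgTensor.lift_tmul (b : M →ₗ[ℂ] N →ₗ[ℂ] X)
    (hb : ∀ m (a : A) n, b (op a • m) n = b m (a • n)) (m : M) (n : N) :
    lift b hb (tmul A m n) = b m n :=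
  (Submodule.liftQ_apply _ _ _).trans (TensorProduct.lift.tmul m n)

variable (A) in
theorem AlgTensor.tmul_balanced (m : M) (a : A) (n : N) :
    tmul A (op a • m) n = tmul A m (a • n) :=
  (Submodule.Quotient.eq _).2 (Submodule.subset_span ⟨m, a, n, rfl⟩)

-- Scalars are absorbed into a factor and `0 = 0 ⊗ 0`, so elementary tensors generate additively and
-- no zero case is needed.
@[elab_as_elim]
theorem AlgTensor.induction_on {motive : AlgTensor A M N → Prop} (t : AlgTensor A M N)
    (tmul : ∀ m n, motive (tmul A m n)) (add : ∀ x y, motive x → motive y → motive (x + y)) :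
    motive t := by
  obtain ⟨t, rfl⟩ := Submodule.Quotient.mk_surjective (balancedRel A M N) t
  induction t using TensorProduct.induction_on with
  | zero =>
    have := tmul 0 0
    rwa [AlgTensor.zero_tmul] at this
  | tmul m n => exact tmul m n
  | add x y hx hy => exact add _ _ hx hy

variable (A M N) in
/-- `(m, n) ↦ m ⊗ n` as a bilinear map. -/
noncomputable def AlgTensor.mk : M →ₗ[ℂ] N →ₗ[ℂ] AlgTensor A M N :=
  (TensorProduct.mk ℂ M N).compr₂ (balancedRel A M N).mkQ

theorem AlgTensor.mk_apply (m : M) (n : N) : AlgTensor.mk A M N m n = tmul A m n := rfl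

variable [UniformSpace M] [UniformSpace N]

theorem AlgTensor.continuous_of_seminorm (q : Seminorm ℂ (AlgTensor A M N))
    (hq : Continuous fun x : M × N => q (tmul A x.1 x.2)) : Continuous q :=
  (AlgTensor.withSeminorms A M N).continuous_seminorm ⟨q, hq⟩

/-- Pulling back a continuous seminorm of `X` along `f` gives one of the seminorms that define the
projective topology. -/
theorem AlgTensor.continuous_of_bilinear [TopologicalSpace X] [PolynormableSpace ℂ X]
    (f : AlgTensor A M N →ₗ[ℂ] X) (hf : Continuous fun x : M × N => f (tmul A x.1 x.2)) :
    Continuous f :=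
  (PolynormableSpace.withSeminorms ℂ X).continuous_of_continuous_comp f fun p =>
    continuous_of_seminorm (p.1.comp f) (p.2.comp hf)

instance : PolynormableSpace ℂ (AlgTensor A M N) :=
  (AlgTensor.withSeminorms A M N).toPolynormableSpace

instance : CompleteLCS (TensorHat A M N) := CompleteLCS.completion

/-- The definition only makes each `p (m ⊗ n)` continuous. Differences are controlled through `x ⊗ y
- m ⊗ n = (x - m) ⊗ n + x ⊗ (y - n)`, where `p` of each summand tends to zero. -/
theorem AlgTensor.continuous_tmul [IsTopologicalAddGroup M] [IsTopologicalAddGroup N] :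
    Continuous fun x : M × N => tmul A x.1 x.2 := by
  rw [continuous_iff_continuousAt]
  rintro ⟨m, n⟩
  refine ((withSeminorms A M N).tendsto_nhds _ _).2 fun p ε hε => ?_
  have h1 : Continuous fun x : M × N => p.1 (tmul A (x.1 - m) n) :=
    p.2.comp (f := fun x : M × N => (x.1 - m, n)) (by fun_prop)
  have h2 : Continuous fun x : M × N => p.1 (tmul A x.1 (x.2 - n)) :=
    p.2.comp (f := fun x : M × N => (x.1, x.2 - n)) (by fun_prop)
  have h := (h1.add h2).tendsto (m, n)
  simp only [Pi.add_apply, sub_self, zero_tmul, tmul_zero, map_zero, add_zero] at h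
  filter_upwards [h.eventually_lt_const hε] with x hx
  refine lt_of_le_of_lt ?_ hx
  refine le_trans (le_of_eq ?_) (map_add_le_add p.1 _ _)
  simp only [← mk_apply, map_sub, LinearMap.sub_apply]
  congr 1
  abel

theorem TensorHat.continuous_tmul [IsTopologicalAddGroup M] [IsTopologicalAddGroup N] :
    Continuous fun x : M × N => tmul A x.1 x.2 :=
  (Completion.continuous_coe _).comp AlgTensor.continuous_tmul

variable (A) in
theorem TensorHat.tmul_balanced (m : M) (a : A) (n : N) :
    tmul A (op a • m) n = tmul A m (a • n) :=
  congrArg _ (AlgTensor.tmul_balanced A m a n)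

variable (A M N) in
/-- `(m, n) ↦ m ⊗ n` as a bilinear map to the completed tensor product. -/
noncomputable def TensorHat.mk : M →ₗ[ℂ] N →ₗ[ℂ] TensorHat A M N :=
  (AlgTensor.mk A M N).compr₂
    { toFun := fun t => (t : TensorHat A M N)
      map_add' := Completion.coe_add
      map_smul' := Completion.coe_smul }

theorem TensorHat.mk_apply (m : M) (n : N) : TensorHat.mk A M N m n = tmul A m n := rfl

theorem TensorHat.hom_ext [TopologicalSpace X] [T2Space X] {f g : TensorHat A M N →L[ℂ] X}
    (h : ∀ m n, f (tmul A m n) = g (tmul A m n)) : f = g := by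
  ext t
  refine Completion.induction_on t (isClosed_eq f.continuous g.continuous) fun s => ?_
  let c : AlgTensor A M N →ₗ[ℂ] TensorHat A M N :=
    { toFun := fun t => (t : TensorHat A M N)
      map_add' := Completion.coe_add
      map_smul' := Completion.coe_smul }
  exact LinearMap.congr_fun
    (AlgTensor.hom_ext A M N (f := f.toLinearMap ∘ₗ c) (g := g.toLinearMap ∘ₗ c) h) s

section Lift

variable [UniformSpace X] [CompleteLCS X]

/-- The continuous linear map on `M ⊗̂_A N` given by a jointly continuous balanced bilinear map. -/
noncomputable def TensorHat.lift (b : M →ₗ[ℂ] N →ₗ[ℂ] X)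
    (hb : ∀ m (a : A) n, b (op a • m) n = b m (a • n))
    (hc : Continuous fun x : M × N => b x.1 x.2) : TensorHat A M N →L[ℂ] X :=
  (AlgTensor.lift b hb).extendCompletion
    (AlgTensor.continuous_of_bilinear _ (by simpa using hc))

@[simp] theorem TensorHat.lift_tmul (b : M →ₗ[ℂ] N →ₗ[ℂ] X)
    (hb : ∀ m (a : A) n, b (op a • m) n = b m (a • n))
    (hc : Continuous fun x : M × N => b x.1 x.2) (m : M) (n : N) :
    lift b hb hc (tmul A m n) = b m n :=
  (LinearMap.extendCompletion_coe _ _ _).trans (AlgTensor.lift_tmul b hb m n)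

end Lift

/-- A bilinear map `P × (M ⊗̂_A N) → X`, continuous in the second variable, is jointly continuous
as soon as the trilinear map `P × M × N → X` is. -/
theorem TensorHat.continuous_uncurry {P : Type*} [AddCommGroup P] [Module ℂ P]
    [TopologicalSpace P] [IsTopologicalAddGroup P] [ContinuousSMul ℂ P]
    [CompleteLCS M] [CompleteLCS N] [UniformSpace X] [CompleteLCS X]
    (F : P →ₗ[ℂ] TensorHat A M N →L[ℂ] X)
    (hF : Continuous fun x : P × M × N => F x.1 (tmul A x.2.1 x.2.2)) :
    Continuous fun x : P × TensorHat A M N => F x.1 x.2 := by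
  have key : ∀ s : Seminorm ℂ X, Continuous s →
      Continuous fun x : P × TensorHat A M N => s (F x.1 x.2) := by
    intro s hs
    refine s.continuous_bilinear (ContinuousLinearMap.coeLM ℂ ∘ₗ F) ?_
    have hF0 : ∀ᶠ x in 𝓝 (0 : P × M × N), s (F x.1 (tmul A x.2.1 x.2.2)) ≤ 1 := by
      refine ((hs.comp hF).tendsto' 0 0 ?_).eventually_le_const one_pos
      simp
    obtain ⟨U, hU, VW, hVW', hUVW⟩ := mem_nhds_prod_iff.1 hF0
    obtain ⟨V, hV, W, hW, hVW⟩ := mem_nhds_prod_iff.1 hVW'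
    have hle : ∀ p ∈ U, ∀ m ∈ V, ∀ n ∈ W, s (F p (tmul A m n)) ≤ 1 := fun p hp m hm n hn =>
      hUVW (Set.mk_mem_prod hp (hVW (Set.mk_mem_prod hm hn)))
    let c : AlgTensor A M N →ₗ[ℂ] TensorHat A M N :=
      { toFun := fun t => (t : TensorHat A M N)
        map_add' := Completion.coe_add
        map_smul' := Completion.coe_smul }
    -- The supremum of these seminorms over `p ∈ U` is a single seminorm on the tensor product that
    -- bounds the whole family uniformly in `p`.
    let r : U → Seminorm ℂ (AlgTensor A M N) := fun p => s.comp ((F p.1).toLinearMap ∘ₗ c)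
    have hr : BddAbove (Set.range r) := by
      rw [Seminorm.bddAbove_range_iff]
      intro t
      induction t using AlgTensor.induction_on with
      | tmul m n =>
        -- Scaling `m` into `V` and `n` into `W` gives a bound independent of `p`.
        obtain ⟨k, hk0, hk⟩ := exists_ne_zero_smul_mem m hV
        obtain ⟨l, hl0, hl⟩ := exists_ne_zero_smul_mem n hW
        refine ⟨‖k‖⁻¹ * ‖l‖⁻¹, ?_⟩
        rintro _ ⟨p, rfl⟩
        have h := hle p.1 p.2 _ hk _ hl
        rw [← mk_apply] at h
        simp only [map_smul, LinearMap.smul_apply, map_smul_eq_mul] at h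
        have hk' := norm_pos_iff.2 hk0
        have hl' := norm_pos_iff.2 hl0
        rw [← mul_inv, ← one_div, le_div_iff₀ (by positivity), mul_comm, mul_comm ‖k‖, mul_assoc]
        exact h
      | add x y hx hy =>
        obtain ⟨Cx, hx⟩ := hx
        obtain ⟨Cy, hy⟩ := hy
        refine ⟨Cx + Cy, ?_⟩
        rintro _ ⟨p, rfl⟩
        exact (map_add_le_add (r p) x y).trans (add_le_add (hx ⟨p, rfl⟩) (hy ⟨p, rfl⟩))
    set q := ⨆ p, r p with hq
    have hqt : ∀ m ∈ V, ∀ n ∈ W, q (AlgTensor.tmul A m n) ≤ 1 := by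
      intro m hm n hn
      rw [hq, Seminorm.iSup_apply hr]
      have : Nonempty U := ⟨⟨0, mem_of_mem_nhds hU⟩⟩
      exact ciSup_le fun p => hle p.1 p.2 m hm n hn
    -- The supremum is still at most `1` on tensors from `V × W`, which suffices for projective
    -- continuity.
    have hqc : Continuous q := by
      refine AlgTensor.continuous_of_seminorm q
        (q.continuous_bilinear (AlgTensor.mk A M N) ?_)
      filter_upwards [prod_mem_nhds hV hW] with x hx using hqt _ hx.1 _ hx.2
    -- Only here does the completion enter: the uniform bound is a closed condition in `t`.
    have hsq : ∀ p ∈ U, ∀ t, s (F p t) ≤ q.completion hqc t := by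
      intro p hp t
      refine Completion.induction_on t
        (isClosed_le (hs.comp (F p).continuous) (q.continuous_completion hqc)) fun t => ?_
      rw [Seminorm.completion_coe, hq, Seminorm.iSup_apply hr]
      exact le_ciSup (f := fun p => r p t) (Seminorm.bddAbove_range_iff.1 hr t) ⟨p, hp⟩
    have hT : {t | q.completion hqc t ≤ 1} ∈ 𝓝 (0 : TensorHat A M N) :=
      ((q.continuous_completion hqc).tendsto' 0 0 (map_zero _)).eventually_le_const one_pos
    filter_upwards [prod_mem_nhds hU hT] with x hx using (hsq _ hx.1 _).trans hx.2
  have hS := PolynormableSpace.withSeminorms ℂ X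
  let f : P →+ TensorHat A M N →+ X :=
    { toFun := fun p => (F p).toLinearMap.toAddMonoidHom
      map_zero' := by ext; simp
      map_add' := fun x y => by ext; simp }
  refine continuous_of_continuousAt_zero₂ f ?_ (fun p => (F p).continuous.continuousAt)
    fun t => ?_
  · refine (hS.tendsto_nhds _ _).2 fun s ε hε => ?_
    simpa [f, Prod.mk_zero_zero] using ((key s.1 s.2).tendsto' 0 0 (by simp)).eventually_lt_const hε
  · refine (hS.tendsto_nhds _ _).2 fun s ε hε => ?_
    have hk : Continuous fun p => s.1 (F p t) := (key s.1 s.2).comp (Continuous.prodMk_left t)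
    simpa [f] using (hk.tendsto' 0 0 (by simp)).eventually_lt_const hε

end UniversalProperty

/-! ### The tensor products `B ⊗̂_A M`, `M ⊗̂_A B` and `B ⊗̂_A B` along `A → B` -/

section ScalarExtension

variable {A B : Type*} [Ring A] [Algebra ℂ A] [UniformSpace A]
  [Ring B] [Algebra ℂ B] [UniformSpace B] [TensorHatAlgebra B] (i : A →A[ℂ] B)
  (M : Type*) [AddCommGroup M] [Module ℂ M] [UniformSpace M] [CompleteLCS M]
  {X : Type*} [AddCommGroup X] [Module ℂ X] [UniformSpace X] [CompleteLCS X]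

namespace TensorHat

section Left

variable [Module A M]

/-- `(b, m) ↦ b ⊗ m` as a bilinear map to `B ⊗̂_A M`. -/
noncomputable def mkLeft : B →ₗ[ℂ] M →ₗ[ℂ] TensorHat A (AlongHom i B) M :=
  TensorHat.mk A (AlongHom i B) M

variable {M}

theorem mkLeft_balanced (b : B) (a : A) (m : M) :
    mkLeft i M (b * i a) m = mkLeft i M b (a • m) :=
  tmul_balanced A (AlongHom.of i B b) a m

theorem continuous_mkLeft : Continuous fun x : B × M => mkLeft i M x.1 x.2 :=
  continuous_tmul (M := AlongHom i B)

variable {i}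

theorem hom_ext_left {Z : Type*} [AddCommGroup Z] [Module ℂ Z] [TopologicalSpace Z] [T2Space Z]
    {f g : TensorHat A (AlongHom i B) M →L[ℂ] Z}
    (h : ∀ b m, f (mkLeft i M b m) = g (mkLeft i M b m)) : f = g :=
  hom_ext h

/-- The continuous linear map on `B ⊗̂_A M` given by a balanced bilinear map on `B × M`. -/
noncomputable def liftLeft (φ : B →ₗ[ℂ] M →ₗ[ℂ] X)
    (hφ : ∀ b a m, φ (b * i a) m = φ b (a • m)) (hc : Continuous fun x : B × M => φ x.1 x.2) :
    TensorHat A (AlongHom i B) M →L[ℂ] X :=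
  lift (M := AlongHom i B) φ hφ hc

@[simp] theorem liftLeft_mkLeft (φ : B →ₗ[ℂ] M →ₗ[ℂ] X)
    (hφ : ∀ b a m, φ (b * i a) m = φ b (a • m)) (hc : Continuous fun x : B × M => φ x.1 x.2)
    (b : B) (m : M) : liftLeft φ hφ hc (mkLeft i M b m) = φ b m :=
  lift_tmul _ _ _ _ _

theorem continuous_uncurry_left {P : Type*} [AddCommGroup P] [Module ℂ P]
    [TopologicalSpace P] [IsTopologicalAddGroup P] [ContinuousSMul ℂ P]
    (F : P →ₗ[ℂ] TensorHat A (AlongHom i B) M →L[ℂ] X)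
    (hF : Continuous fun x : P × B × M => F x.1 (mkLeft i M x.2.1 x.2.2)) :
    Continuous fun x : P × TensorHat A (AlongHom i B) M => F x.1 x.2 :=
  continuous_uncurry F hF

variable (i M)

/-- Left multiplication by `b` on `B ⊗̂_A M`. -/
noncomputable def leftEnd (b : B) :
    TensorHat A (AlongHom i B) M →L[ℂ] TensorHat A (AlongHom i B) M :=
  liftLeft ((mkLeft i M).comp (LinearMap.mulLeft ℂ b))
    (fun c a m => by
      simpa only [LinearMap.comp_apply, LinearMap.mulLeft_apply, mul_assoc] using
        mkLeft_balanced i (b * c) a m)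
    ((continuous_mkLeft i).comp (f := fun x : B × M => (b * x.1, x.2)) (by fun_prop))

@[simp] theorem leftEnd_mkLeft (b c : B) (m : M) :
    leftEnd i M b (mkLeft i M c m) = mkLeft i M (b * c) m :=
  liftLeft_mkLeft _ _ _ _ _

/-- Left multiplication of `B` on `B ⊗̂_A M`, as a linear map. -/
noncomputable def leftEndₗ :
    B →ₗ[ℂ] TensorHat A (AlongHom i B) M →L[ℂ] TensorHat A (AlongHom i B) M where
  toFun := leftEnd i M
  map_add' b c := hom_ext_left fun d m => by simp [add_mul]
  map_smul' z c := hom_ext_left fun d m => by simp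

/-- Here `B` acts through the outer factor, in addition to the `A`-action that every tensor product
of bimodules carries. -/
noncomputable instance : Module B (TensorHat A (AlongHom i B) M) :=
  Module.compHom (R := TensorHat A (AlongHom i B) M →L[ℂ] TensorHat A (AlongHom i B) M) _
    { toFun := leftEnd i M
      map_one' := hom_ext_left fun d m => by simp
      map_mul' := fun b c => hom_ext_left fun d m => by simp [mul_assoc]
      map_zero' := map_zero (leftEndₗ i M)
      map_add' := map_add (leftEndₗ i M) }

@[simp] theorem smul_mkLeft (b c : B) (m : M) :
    b • mkLeft i M c m = mkLeft i M (b * c) m :=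
  leftEnd_mkLeft i M b c m

instance : IsScalarTower ℂ B (TensorHat A (AlongHom i B) M) :=
  ⟨fun z b t => congrArg (fun f => f t) (map_smul (leftEndₗ i M) z b)⟩

instance : ContinuousSMul B (TensorHat A (AlongHom i B) M) :=
  ⟨continuous_uncurry_left (leftEndₗ i M) (by
    have h : Continuous fun x : B × B × M => mkLeft i M (x.1 * x.2.1) x.2.2 :=
      (continuous_mkLeft i).comp (f := fun x : B × B × M => (x.1 * x.2.1, x.2.2)) (by fun_prop)
    exact h.congr fun x => (leftEnd_mkLeft i M x.1 x.2.1 x.2.2).symm)⟩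

end Left

section Right

variable [Module Aᵐᵒᵖ M]

/-- `(m, b) ↦ m ⊗ b` as a bilinear map to `M ⊗̂_A B`. -/
noncomputable def mkRight : M →ₗ[ℂ] B →ₗ[ℂ] TensorHat A M (AlongHom i B) :=
  TensorHat.mk A M (AlongHom i B)

variable {M}

theorem mkRight_balanced (m : M) (a : A) (b : B) :
    mkRight i M (op a • m) b = mkRight i M m (i a * b) :=
  tmul_balanced A m a (AlongHom.of i B b)

theorem continuous_mkRight : Continuous fun x : M × B => mkRight i M x.1 x.2 :=
  continuous_tmul (N := AlongHom i B)

variable {i}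

theorem hom_ext_right {Z : Type*} [AddCommGroup Z] [Module ℂ Z] [TopologicalSpace Z] [T2Space Z]
    {f g : TensorHat A M (AlongHom i B) →L[ℂ] Z}
    (h : ∀ m b, f (mkRight i M m b) = g (mkRight i M m b)) : f = g :=
  hom_ext h

/-- The continuous linear map on `M ⊗̂_A B` given by a balanced bilinear map on `M × B`. -/
noncomputable def liftRight (φ : M →ₗ[ℂ] B →ₗ[ℂ] X)
    (hφ : ∀ m a b, φ (op a • m) b = φ m (i a * b)) (hc : Continuous fun x : M × B => φ x.1 x.2) :
    TensorHat A M (AlongHom i B) →L[ℂ] X :=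
  lift (N := AlongHom i B) φ hφ hc

@[simp] theorem liftRight_mkRight (φ : M →ₗ[ℂ] B →ₗ[ℂ] X)
    (hφ : ∀ m a b, φ (op a • m) b = φ m (i a * b)) (hc : Continuous fun x : M × B => φ x.1 x.2)
    (m : M) (b : B) : liftRight φ hφ hc (mkRight i M m b) = φ m b :=
  lift_tmul _ _ _ _ _

theorem continuous_uncurry_right {P : Type*} [AddCommGroup P] [Module ℂ P]
    [TopologicalSpace P] [IsTopologicalAddGroup P] [ContinuousSMul ℂ P]
    (F : P →ₗ[ℂ] TensorHat A M (AlongHom i B) →L[ℂ] X)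
    (hF : Continuous fun x : P × M × B => F x.1 (mkRight i M x.2.1 x.2.2)) :
    Continuous fun x : P × TensorHat A M (AlongHom i B) => F x.1 x.2 :=
  continuous_uncurry F hF

variable (i M)

/-- Right multiplication by `b` on `M ⊗̂_A B`. -/
noncomputable def rightEnd (b : B) :
    TensorHat A M (AlongHom i B) →L[ℂ] TensorHat A M (AlongHom i B) :=
  liftRight ((mkRight i M).compl₂ (LinearMap.mulRight ℂ b))
    (fun m a c => by
      simpa only [LinearMap.compl₂_apply, LinearMap.mulRight_apply, mul_assoc] using
        mkRight_balanced i m a (c * b))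
    ((continuous_mkRight i).comp (f := fun x : M × B => (x.1, x.2 * b)) (by fun_prop))

@[simp] theorem rightEnd_mkRight (b c : B) (m : M) :
    rightEnd i M b (mkRight i M m c) = mkRight i M m (c * b) :=
  liftRight_mkRight _ _ _ _ _

/-- Right multiplication of `B` on `M ⊗̂_A B`, as a linear map. -/
noncomputable def rightEndₗ :
    B →ₗ[ℂ] TensorHat A M (AlongHom i B) →L[ℂ] TensorHat A M (AlongHom i B) where
  toFun := rightEnd i M
  map_add' b c := hom_ext_right fun m d => by simp [mul_add]
  map_smul' z c := hom_ext_right fun m d => by simp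

noncomputable instance : Module Bᵐᵒᵖ (TensorHat A M (AlongHom i B)) :=
  Module.compHom (R := TensorHat A M (AlongHom i B) →L[ℂ] TensorHat A M (AlongHom i B)) _
    { toFun := fun b => rightEnd i M b.unop
      map_one' := hom_ext_right fun m d => by simp
      map_mul' := fun b c => hom_ext_right fun m d => by simp [mul_assoc]
      map_zero' := map_zero (rightEndₗ i M)
      map_add' := fun b c => map_add (rightEndₗ i M) b.unop c.unop }

@[simp] theorem op_smul_mkRight (b c : B) (m : M) :
    op b • mkRight i M m c = mkRight i M m (c * b) :=
  rightEnd_mkRight i M b c m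

instance : IsScalarTower ℂ Bᵐᵒᵖ (TensorHat A M (AlongHom i B)) :=
  ⟨fun z b t => congrArg (fun f => f t) (map_smul (rightEndₗ i M) z b.unop)⟩

instance : ContinuousSMul Bᵐᵒᵖ (TensorHat A M (AlongHom i B)) :=
  ⟨by
    have h : Continuous fun x : B × TensorHat A M (AlongHom i B) => rightEndₗ i M x.1 x.2 := by
      refine continuous_uncurry_right (rightEndₗ i M) ?_
      have h : Continuous fun x : B × M × B => mkRight i M x.2.1 (x.2.2 * x.1) :=
        (continuous_mkRight i).comp (f := fun x : B × M × B => (x.2.1, x.2.2 * x.1)) (by fun_prop)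
      exact h.congr fun x => (rightEnd_mkRight i M x.1 x.2.2 x.2.1).symm
    have h' : Continuous fun x : Bᵐᵒᵖ × TensorHat A M (AlongHom i B) =>
        rightEndₗ i M x.1.unop x.2 :=
      h.comp (f := fun x : Bᵐᵒᵖ × TensorHat A M (AlongHom i B) => (x.1.unop, x.2)) (by fun_prop)
    exact h'⟩

end Right

section Both

/-- `(b, c) ↦ b ⊗ c` as a bilinear map to `B ⊗̂_A B`. -/
noncomputable def mkBoth : B →ₗ[ℂ] B →ₗ[ℂ] TensorHat A (AlongHom i B) (AlongHom i B) :=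
  TensorHat.mk A (AlongHom i B) (AlongHom i B)

theorem mkBoth_balanced (b : B) (a : A) (c : B) :
    mkBoth i (b * i a) c = mkBoth i b (i a * c) :=
  tmul_balanced A (AlongHom.of i B b) a (AlongHom.of i B c)

theorem continuous_mkBoth : Continuous fun x : B × B => mkBoth i x.1 x.2 :=
  continuous_tmul (M := AlongHom i B) (N := AlongHom i B)

variable {i}

theorem hom_ext_both {Z : Type*} [AddCommGroup Z] [Module ℂ Z] [TopologicalSpace Z] [T2Space Z]
    {f g : TensorHat A (AlongHom i B) (AlongHom i B) →L[ℂ] Z}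
    (h : ∀ b c, f (mkBoth i b c) = g (mkBoth i b c)) : f = g :=
  hom_ext h

/-- The continuous linear map on `B ⊗̂_A B` given by a balanced bilinear map on `B × B`. -/
noncomputable def liftBoth (φ : B →ₗ[ℂ] B →ₗ[ℂ] X)
    (hφ : ∀ b a c, φ (b * i a) c = φ b (i a * c)) (hc : Continuous fun x : B × B => φ x.1 x.2) :
    TensorHat A (AlongHom i B) (AlongHom i B) →L[ℂ] X :=
  lift (M := AlongHom i B) (N := AlongHom i B) φ hφ hc

@[simp] theorem liftBoth_mkBoth (φ : B →ₗ[ℂ] B →ₗ[ℂ] X)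
    (hφ : ∀ b a c, φ (b * i a) c = φ b (i a * c)) (hc : Continuous fun x : B × B => φ x.1 x.2)
    (b c : B) : liftBoth φ hφ hc (mkBoth i b c) = φ b c :=
  lift_tmul _ _ _ _ _

variable (i)

@[simp] theorem smul_mkBoth (b c d : B) : b • mkBoth i c d = mkBoth i (b * c) d :=
  smul_mkLeft i (AlongHom i B) b c (AlongHom.of i B d)

@[simp] theorem op_smul_mkBoth (b c d : B) : op b • mkBoth i c d = mkBoth i c (d * b) :=
  op_smul_mkRight i (AlongHom i B) b d (AlongHom.of i B c)

instance : SMulCommClass B Bᵐᵒᵖ (TensorHat A (AlongHom i B) (AlongHom i B)) :=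
  ⟨fun b c t => congrArg (fun f => f t) (hom_ext_both
    (f := (leftEnd i (AlongHom i B) b).comp (rightEnd i (AlongHom i B) c.unop))
    (g := (rightEnd i (AlongHom i B) c.unop).comp (leftEnd i (AlongHom i B) b)) fun x y => by
      change b • op c.unop • mkBoth i x y = op c.unop • b • mkBoth i x y
      rw [op_smul_mkBoth, smul_mkBoth, smul_mkBoth, op_smul_mkBoth])⟩

/-- This is the bimodule in which centrality of `1 ⊗ 1` will be tested. -/
instance : TensorHatBimodule B (TensorHat A (AlongHom i B) (AlongHom i B)) where
  isScalarTower_left := inferInstance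
  isScalarTower_right := inferInstance
  smulCommClass := inferInstance
  continuousSMul_left := inferInstance
  continuousSMul_right := inferInstance

end Both

end TensorHat

end ScalarExtension

/-! ### Epimorphisms of `⊗̂`-algebras -/

/-- The topology is that of the product, hence the infimum of two induced locally convex topologies.
Homomorphisms into this algebra encode derivations with values in `E`. -/
instance TrivSqZeroExt.tensorHatAlgebra {B E : Type*} [Ring B] [Algebra ℂ B] [UniformSpace B]
    [TensorHatAlgebra B] [AddCommGroup E] [Module ℂ E] [UniformSpace E] [CompleteLCS E]
    [Module B E] [Module Bᵐᵒᵖ E] [TensorHatBimodule B E] :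
    TensorHatAlgebra (TrivSqZeroExt B E) where
  withSeminorms' := by
    have h1 := PolynormableSpace.induced (𝕜 := ℂ)
      (TrivSqZeroExt.fstHom ℂ B E).toLinearMap
    have h2 := PolynormableSpace.induced (𝕜 := ℂ) (F := E)
      (TrivSqZeroExt.sndHom B E |>.restrictScalars ℂ)
    exact (h1.inf h2).withSeminorms'

section Epi

variable {A B : Type u} [Ring A] [Algebra ℂ A] [UniformSpace A]
  [Ring B] [Algebra ℂ B] [UniformSpace B] [TensorHatAlgebra B] {i : A →A[ℂ] B}

/-- The inner derivation `b ↦ b e - e b` vanishes on the image of `A`. Adding it to the inclusion `B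
→ B ⊕ E` therefore gives a second homomorphism that agrees with the inclusion on `A`, and the
epimorphism property forces the derivation to be zero. -/
theorem IsTensorHatEpi.central (hi : IsTensorHatEpi i) {E : Type u} [AddCommGroup E] [Module ℂ E]
    [UniformSpace E] [CompleteLCS E] [Module B E] [Module Bᵐᵒᵖ E] [TensorHatBimodule B E]
    (e : E) (he : ∀ a, i a • e = op (i a) • e) (b : B) : b • e = op b • e := by
  let f : B →A[ℂ] TrivSqZeroExt B E :=
    { TrivSqZeroExt.inlAlgHom ℂ B E with cont := TrivSqZeroExt.continuous_inl }
  let g : B →A[ℂ] TrivSqZeroExt B E :=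
    { toFun := fun b => TrivSqZeroExt.inl b + TrivSqZeroExt.inr (b • e - op b • e)
      map_one' := by simp
      map_mul' := fun b c => by
        ext
        · simp
        · simp [mul_smul, smul_sub, smul_comm]
      map_zero' := by simp
      map_add' := fun b c => by
        ext
        · simp
        · simp [add_smul]; abel
      commutes' := fun z => by
        ext
        · simp [TrivSqZeroExt.algebraMap_eq_inl']
        · simp [Algebra.algebraMap_eq_smul_one]
      cont := by
        have h : Continuous fun b : B => b • e - op b • e := by fun_prop
        have h1 : Continuous (TrivSqZeroExt.inl : B → TrivSqZeroExt B E) :=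
          TrivSqZeroExt.continuous_inl
        have h2 : Continuous (TrivSqZeroExt.inr : E → TrivSqZeroExt B E) :=
          TrivSqZeroExt.continuous_inr
        exact h1.add (h2.comp h) }
  have hfg := hi _ f g fun a => by
    change (TrivSqZeroExt.inl (i a) : TrivSqZeroExt B E) =
      TrivSqZeroExt.inl (i a) + TrivSqZeroExt.inr (i a • e - op (i a) • e)
    rw [he a, sub_self, TrivSqZeroExt.inr_zero, add_zero]
  have := congrArg (fun h => (h b).snd) hfg
  change (0 : E) =
    TrivSqZeroExt.snd (TrivSqZeroExt.inl b + TrivSqZeroExt.inr (b • e - op b • e)) at this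
  simpa [sub_eq_zero, eq_comm] using this

/-- For an epimorphism `A → B`, one has `b ⊗ 1 = 1 ⊗ b` in `B ⊗̂_A B`. -/
theorem IsTensorHatEpi.mkBoth_one (hi : IsTensorHatEpi i) (b : B) :
    TensorHat.mkBoth i b 1 = TensorHat.mkBoth i 1 b := by
  have := hi.central (TensorHat.mkBoth i 1 1)
    (fun a => by simpa using TensorHat.mkBoth_balanced i 1 a 1) b
  simpa using this

/-- For an epimorphism `A → B`, every jointly continuous `A`-balanced bilinear map `φ` on `B × B`
satisfies `φ (b, 1) = φ (1, b)`. -/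
theorem IsTensorHatEpi.apply_one (hi : IsTensorHatEpi i) {X : Type*} [AddCommGroup X] [Module ℂ X]
    [UniformSpace X] [CompleteLCS X] (φ : B →ₗ[ℂ] B →ₗ[ℂ] X)
    (hφ : ∀ b a c, φ (b * i a) c = φ b (i a * c)) (hc : Continuous fun x : B × B => φ x.1 x.2)
    (b : B) : φ b 1 = φ 1 b := by
  simpa using congrArg (TensorHat.liftBoth φ hφ hc) (hi.mkBoth_one b)

/-- The inverse is `x ↦ x ⊗ 1`, since `x ⊗ y = x (1 ⊗ y) = x (y ⊗ 1) = x y ⊗ 1`. -/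
theorem IsTensorHatEpi.mulIsTopIso (hi : IsTensorHatEpi i) : MulIsTopIso i := by
  let m : TensorHat A (AlongHom i B) (AlongHom i B) →L[ℂ] B :=
    TensorHat.liftBoth (LinearMap.mul ℂ B) (fun b a c => mul_assoc b (i a) c) continuous_mul
  have hm : ∀ x y, m (TensorHat.mkBoth i x y) = x * y := fun x y =>
    TensorHat.liftBoth_mkBoth _ _ _ _ _
  let s : B →L[ℂ] TensorHat A (AlongHom i B) (AlongHom i B) :=
    ⟨(TensorHat.mkBoth i).flip 1,
      (TensorHat.continuous_mkBoth i).comp (f := fun x : B => (x, (1 : B))) (by fun_prop)⟩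
  have hs : ∀ x, s x = TensorHat.mkBoth i x 1 := fun _ => rfl
  refine ⟨ContinuousLinearEquiv.equivOfInverse m s (fun t => ?_) fun b => ?_, hm⟩
  · refine congrArg (fun f => f t) (TensorHat.hom_ext_both
      (f := s.comp m) (g := ContinuousLinearMap.id ℂ _) fun x y => ?_)
    have := congrArg (fun t => x • t) (hi.mkBoth_one y)
    simpa [hm, hs] using this
  · rw [hs, hm, mul_one]

/-- Injectivity of multiplication gives `b ⊗ 1 = 1 ⊗ b`. If `f` and `g` agree on `A`, then `x ⊗ y ↦
f x * g y` is well defined, and it sends these two tensors to `f b` and `g b`. -/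
theorem MulIsTopIso.isTensorHatEpi (hi : MulIsTopIso i) : IsTensorHatEpi i := by
  obtain ⟨μ, hμ⟩ := hi
  intro C _ _ _ _ f g hfg
  let φ : B →ₗ[ℂ] B →ₗ[ℂ] C :=
    (LinearMap.mul ℂ C).compl₁₂ f.toAlgHom.toLinearMap g.toAlgHom.toLinearMap
  have hφ : ∀ x y, φ x y = f x * g y := fun _ _ => rfl
  have hb : ∀ b a c, φ (b * i a) c = φ b (i a * c) := fun b a c => by
    rw [hφ, hφ, map_mul, map_mul, hfg, mul_assoc]
  have hc : Continuous fun x : B × B => φ x.1 x.2 := by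
    have hf := f.continuous
    have hg := g.continuous
    simp only [hφ]
    fun_prop
  let Φ := TensorHat.liftBoth φ hb hc
  have hΦ : ∀ x y : B, Φ (TensorHat.mkBoth i x y) = f x * g y :=
    fun x y => TensorHat.liftBoth_mkBoth φ hb hc x y
  ext b
  have hμ' : ∀ x y : B, μ (TensorHat.mkBoth i x y) = x * y := hμ
  have h : TensorHat.mkBoth i b 1 = TensorHat.mkBoth i 1 b :=
    μ.injective (by rw [hμ', hμ', mul_one, one_mul])
  simpa [hΦ] using congrArg Φ h

theorem isTensorHatEpi_iff_mulIsTopIso : IsTensorHatEpi i ↔ MulIsTopIso i :=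
  ⟨IsTensorHatEpi.mulIsTopIso, MulIsTopIso.isTensorHatEpi⟩

end Epi

/-! ### Linearity of bimodule maps along epimorphisms -/

section EpiLinear

variable {A B : Type u} [Ring A] [Algebra ℂ A] [UniformSpace A]
  [Ring B] [Algebra ℂ B] [UniformSpace B] [TensorHatAlgebra B] {i : A →A[ℂ] B}
  {X Y : Type*} [AddCommGroup X] [Module ℂ X] [UniformSpace X]
  [AddCommGroup Y] [Module ℂ Y] [UniformSpace Y] [CompleteLCS Y]

/-- Along an epimorphism `A → B`, continuous left `A`-linear maps of left `B`-modules are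
`B`-linear. -/
theorem IsTensorHatEpi.map_smul (hi : IsTensorHatEpi i)
    [Module B X] [IsScalarTower ℂ B X] [ContinuousSMul B X]
    [Module B Y] [IsScalarTower ℂ B Y] [ContinuousSMul B Y] (f : X →L[ℂ] Y)
    (hf : ∀ a x, f (i a • x) = i a • f x) (b : B) (x : X) : f (b • x) = b • f x := by
  -- The balanced map is `(b, c) ↦ b • f (c • x)`; its values at `(b, 1)` and `(1, b)` are the two
  -- sides.
  have := hi.apply_one
    (LinearMap.mk₂ ℂ (fun b c : B => b • f (c • x)) (fun b b' c => add_smul _ _ _)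
      (fun z b c => smul_assoc _ _ _) (fun b c c' => by rw [add_smul, map_add, smul_add])
      (fun z b c => by rw [smul_assoc, _root_.map_smul, smul_comm]))
    (fun b a c => by simp [mul_smul, hf])
    (by
      have := f.continuous
      simp only [LinearMap.mk₂_apply]
      fun_prop) b
  simpa using this.symm

/-- Along an epimorphism `A → B`, continuous right `A`-linear maps of right `B`-modules are
`B`-linear. -/
theorem IsTensorHatEpi.map_op_smul (hi : IsTensorHatEpi i)
    [Module Bᵐᵒᵖ X] [IsScalarTower ℂ Bᵐᵒᵖ X] [ContinuousSMul Bᵐᵒᵖ X]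
    [Module Bᵐᵒᵖ Y] [IsScalarTower ℂ Bᵐᵒᵖ Y] [ContinuousSMul Bᵐᵒᵖ Y] (f : X →L[ℂ] Y)
    (hf : ∀ a x, f (op (i a) • x) = op (i a) • f x) (b : B) (x : X) :
    f (op b • x) = op b • f x := by
  have := hi.apply_one
    (LinearMap.mk₂ ℂ (fun b c : B => op c • f (op b • x))
      (fun b b' c => by rw [MulOpposite.op_add, add_smul, map_add, smul_add])
      (fun z b c => by rw [MulOpposite.op_smul, smul_assoc, _root_.map_smul, smul_comm])
      (fun b c c' => by rw [MulOpposite.op_add, add_smul])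
      (fun z b c => by rw [MulOpposite.op_smul, smul_assoc]))
    (fun b a c => by simp [mul_smul, hf])
    (by
      have := f.continuous
      simp only [LinearMap.mk₂_apply]
      fun_prop) b
  simpa using this

end EpiLinear

/-! ### The `A`-actions on `B ⊗̂_A M` and `M ⊗̂_A B` -/

namespace TensorHat

/-- Additivity suffices, because elementary tensors generate a dense additive subgroup. Module
actions can thus be compared without first checking that they are `ℂ`-linear. -/
theorem addHom_ext {A M N X : Type*} [Ring A]
    [AddCommGroup M] [Module ℂ M] [Module Aᵐᵒᵖ M] [AddCommGroup N] [Module ℂ N] [Module A N]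
    [UniformSpace M] [UniformSpace N] [AddCommGroup X] [TopologicalSpace X] [T2Space X]
    {f g : TensorHat A M N →+ X} (hf : Continuous f) (hg : Continuous g)
    (h : ∀ m n, f (tmul A m n) = g (tmul A m n)) (t : TensorHat A M N) : f t = g t := by
  refine Completion.induction_on t (isClosed_eq hf hg) fun s => ?_
  induction s using AlgTensor.induction_on with
  | tmul m n => exact h m n
  | add x y hx hy => rw [Completion.coe_add, map_add, map_add, hx, hy]

section

variable {A B : Type*} [Ring A] [Algebra ℂ A] [UniformSpace A]
  [Ring B] [Algebra ℂ B] [UniformSpace B] [TensorHatAlgebra B] {i : A →A[ℂ] B}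
  {M : Type*} [AddCommGroup M] [Module ℂ M] [UniformSpace M] [CompleteLCS M]
  [Module A M] [Module Aᵐᵒᵖ M] [TensorHatBimodule A M]

theorem op_smul_mkLeft (a : A) (b : B) (m : M) :
    op a • mkLeft i M b m = mkLeft i M b (op a • m) :=
  op_smul_tmul A a (AlongHom.of i B b) m

theorem smul_mkRight (a : A) (m : M) (b : B) :
    a • mkRight i M m b = mkRight i M (a • m) b :=
  smul_tmul A a m (AlongHom.of i B b)

theorem addHom_ext_left {X : Type*} [AddCommGroup X] [TopologicalSpace X] [T2Space X]
    {f g : TensorHat A (AlongHom i B) M →+ X} (hf : Continuous f) (hg : Continuous g)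
    (h : ∀ b m, f (mkLeft i M b m) = g (mkLeft i M b m)) (t : TensorHat A (AlongHom i B) M) :
    f t = g t :=
  addHom_ext hf hg h t

theorem addHom_ext_right {X : Type*} [AddCommGroup X] [TopologicalSpace X] [T2Space X]
    {f g : TensorHat A M (AlongHom i B) →+ X} (hf : Continuous f) (hg : Continuous g)
    (h : ∀ m b, f (mkRight i M m b) = g (mkRight i M m b)) (t : TensorHat A M (AlongHom i B)) :
    f t = g t :=
  addHom_ext hf hg h t

/-- The two sides come from independent constructions, completion of the algebraic action and
lifting through the outer factor, so their agreement has to be checked on elementary tensors. -/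
theorem smul_eq_outer_smul (a : A) (t : TensorHat A (AlongHom i B) M) : a • t = i a • t :=
  addHom_ext_left (f := DistribSMul.toAddMonoidHom _ a) (g := DistribSMul.toAddMonoidHom _ (i a))
    (continuous_const_smul a) (continuous_const_smul (i a)) (fun b m => by
      change a • mkLeft i M b m = i a • mkLeft i M b m
      rw [smul_mkLeft]
      exact smul_tmul A a (AlongHom.of i B b) m) t

theorem op_smul_eq_outer_op_smul (a : A) (t : TensorHat A M (AlongHom i B)) :
    op a • t = op (i a) • t :=
  addHom_ext_right (f := DistribSMul.toAddMonoidHom _ (op a))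
    (g := DistribSMul.toAddMonoidHom _ (op (i a)))
    (continuous_const_smul (op a)) (continuous_const_smul (op (i a))) (fun m b => by
      change op a • mkRight i M m b = op (i a) • mkRight i M m b
      rw [op_smul_mkRight]
      exact op_smul_tmul A a m (AlongHom.of i B b)) t

theorem smul_outer_op_smul_comm (a : A) (b : B) (t : TensorHat A M (AlongHom i B)) :
    a • op b • t = op b • a • t :=
  addHom_ext_right
    (f := (DistribSMul.toAddMonoidHom _ a).comp (DistribSMul.toAddMonoidHom _ (op b)))
    (g := (DistribSMul.toAddMonoidHom _ (op b)).comp (DistribSMul.toAddMonoidHom _ a))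
    ((continuous_const_smul a).comp (continuous_const_smul (op b)))
    ((continuous_const_smul (op b)).comp (continuous_const_smul a)) (fun m c => by
      change a • op b • mkRight i M m c = op b • a • mkRight i M m c
      rw [op_smul_mkRight, smul_mkRight, smul_mkRight, op_smul_mkRight]) t

end

end TensorHat

/-! ### Envelopes of bimodules -/

section BimoduleEnvelope

variable {A B M MH : Type u} [Ring A] [Algebra ℂ A] [UniformSpace A]
  [Ring B] [Algebra ℂ B] [UniformSpace B] [TensorHatAlgebra B] {i : A →A[ℂ] B}
  [AddCommGroup M] [Module ℂ M] [UniformSpace M] [CompleteLCS M]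
  [Module A M] [Module Aᵐᵒᵖ M] [TensorHatBimodule A M]
  [AddCommGroup MH] [Module ℂ MH] [UniformSpace MH] [CompleteLCS MH]
  [Module B MH] [Module Bᵐᵒᵖ MH] [TensorHatBimodule B MH] {j : M →L[ℂ] MH}

namespace IsBimoduleArensMichaelEnvelope

/-- Automatic linearity makes `h` a `B`-bimodule map, so it is compared with the identity by the
uniqueness half of the universal property. Only `A`-linearity has to be verified in applications. -/
theorem eq_id (hi : IsTensorHatEpi i) (hj : IsBimoduleArensMichaelEnvelope i j)
    (h : MH →L[ℂ] MH) (hl : ∀ a x, h (i a • x) = i a • h x)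
    (hr : ∀ a x, h (op (i a) • x) = op (i a) • h x) (hj' : ∀ m, h (j m) = j m) :
    h = ContinuousLinearMap.id ℂ MH :=
  (hj.2 MH j hj.1).unique ⟨⟨hi.map_smul h hl, hi.map_op_smul h hr⟩, hj'⟩
    ⟨⟨fun _ _ => rfl, fun _ _ => rfl⟩, fun _ => rfl⟩

/-- The universal property of the envelope, for a left `B`-module `X` whose right `B`-module
structure is transported from `Y`. -/
theorem exists_lift_transport (hj : IsBimoduleArensMichaelEnvelope i j) {X Y : Type u}
    [AddCommGroup X] [Module ℂ X] [UniformSpace X] [CompleteLCS X]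
    [Module B X] [IsScalarTower ℂ B X] [ContinuousSMul B X]
    [AddCommGroup Y] [Module ℂ Y] [UniformSpace Y]
    [Module Bᵐᵒᵖ Y] [IsScalarTower ℂ Bᵐᵒᵖ Y] [ContinuousSMul Bᵐᵒᵖ Y]
    (e : Y ≃L[ℂ] X)
    (hcomm : ∀ (b c : B) (x : X), b • e (op c • e.symm x) = e (op c • e.symm (b • x)))
    (f : M →L[ℂ] X) (hl : ∀ a m, f (a • m) = i a • f m)
    (hr : ∀ a m, f (op a • m) = e (op (i a) • e.symm (f m))) :
    ∃ g : MH →L[ℂ] X, (∀ (b : B) x, g (b • x) = b • g x) ∧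
      (∀ (b : B) x, g (op b • x) = e (op b • e.symm (g x))) ∧ ∀ m, g (j m) = f m := by
  let _ : Module Bᵐᵒᵖ X := e.symm.toLinearEquiv.toAddEquiv.module Bᵐᵒᵖ
  have hop : ∀ (c : Bᵐᵒᵖ) (x : X), c • x = e (c • e.symm x) := fun _ _ => rfl
  have : TensorHatBimodule B X :=
    { isScalarTower_left := inferInstance
      isScalarTower_right := ⟨fun z c x => by rw [hop, hop, smul_assoc, map_smul]⟩
      smulCommClass := ⟨fun b c x => hcomm b c.unop x⟩
      continuousSMul_left := inferInstance
      continuousSMul_right := ⟨by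
        have h1 := e.continuous
        have h2 := e.symm.continuous
        simp only [hop]
        fun_prop⟩ }
  obtain ⟨g, ⟨⟨h1, h2⟩, h3⟩, -⟩ := hj.2 X f ⟨hl, hr⟩
  exact ⟨g, h1, h2, h3⟩

/-- The envelope of `M` is `B ⊗̂_A M`, and it is a quotient of `M ⊗̂_A B`. -/
theorem exists_equiv (hi : IsTensorHatEpi i) (hj : IsBimoduleArensMichaelEnvelope i j)
    (hM : TopBimoduleIso A (TensorHat A M (AlongHom i B)) (TensorHat A (AlongHom i B) M)) :
    (∃ θ : TensorHat A (AlongHom i B) M ≃L[ℂ] MH,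
      ∀ b m, θ (TensorHat.mkLeft i M b m) = b • j m) ∧
    ∃ ρ : TensorHat A M (AlongHom i B) →L[ℂ] MH, Function.Surjective ρ ∧
      ∀ m b, ρ (TensorHat.mkRight i M m b) = op b • j m := by
  obtain ⟨e, hel, her⟩ := hM
  replace hel : ∀ (a : A) t, e (a • t) = a • e t := hel
  replace her : ∀ (a : A) t, e (op a • t) = op a • e t := her
  have hel' : ∀ (a : A) x, e.symm (a • x) = a • e.symm x := fun a x => by
    rw [e.symm_apply_eq, hel, e.apply_symm_apply]
  have her' : ∀ (a : A) x, e (op (i a) • e.symm x) = op a • x := fun a x => by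
    rw [← TensorHat.op_smul_eq_outer_op_smul, her, e.apply_symm_apply]
  -- Right multiplication by `c`, carried over from `M ⊗̂_A B`, is left `A`-linear because `e` is;
  -- the epimorphism property upgrades this to left `B`-linearity.
  have hcomm : ∀ (b c : B) x, b • e (op c • e.symm x) = e (op c • e.symm (b • x)) := by
    intro b c x
    let f : TensorHat A (AlongHom i B) M →L[ℂ] TensorHat A (AlongHom i B) M :=
      (e : _ →L[ℂ] _).comp ((TensorHat.rightEnd i M c).comp (e.symm : _ →L[ℂ] _))
    have hf : ∀ x, f x = e (op c • e.symm x) := fun _ => rfl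
    have := hi.map_smul f (fun a x => by
      rw [hf, hf, ← TensorHat.smul_eq_outer_smul, ← TensorHat.smul_eq_outer_smul, hel',
        ← TensorHat.smul_outer_op_smul_comm, hel]) b x
    rw [hf, hf] at this
    exact this.symm
  obtain ⟨hjl, hjr⟩ := hj.1
  let θ : TensorHat A (AlongHom i B) M →L[ℂ] MH := TensorHat.liftLeft
    (LinearMap.mk₂ ℂ (fun (b : B) m => b • j m) (fun b b' m => add_smul _ _ _)
      (fun z b m => smul_assoc _ _ _) (fun b m m' => by rw [map_add, smul_add])
      (fun z b m => by rw [_root_.map_smul, smul_comm]))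
    (fun b a m => by simp [mul_smul, hjl])
    (by
      have := j.continuous
      simp only [LinearMap.mk₂_apply]
      fun_prop)
  have hθ : ∀ b m, θ (TensorHat.mkLeft i M b m) = b • j m := fun b m => by
    simp [θ]
  let ρ : TensorHat A M (AlongHom i B) →L[ℂ] MH := TensorHat.liftRight
    (LinearMap.mk₂ ℂ (fun m (b : B) => op b • j m) (fun m m' b => by rw [map_add, smul_add])
      (fun z b m => by rw [_root_.map_smul, smul_comm])
      (fun m b b' => by rw [MulOpposite.op_add, add_smul])
      (fun z m b => by rw [MulOpposite.op_smul, smul_assoc]))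
    (fun m a b => by simp [mul_smul, hjr])
    (by
      have := j.continuous
      simp only [LinearMap.mk₂_apply]
      fun_prop)
  have hρ : ∀ m b, ρ (TensorHat.mkRight i M m b) = op b • j m := fun m b => by
    simp [ρ]
  have hθl : ∀ (b : B) t, θ (b • t) = b • θ t := fun b t =>
    TensorHat.addHom_ext_left (f := θ.toLinearMap.toAddMonoidHom.comp (DistribSMul.toAddMonoidHom _ b))
      (g := (DistribSMul.toAddMonoidHom _ b).comp θ.toLinearMap.toAddMonoidHom)
      (θ.continuous.comp (continuous_const_smul b)) (θ.continuous.const_smul b)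
      (fun c m => by
        change θ (b • TensorHat.mkLeft i M c m) = b • θ (TensorHat.mkLeft i M c m)
        rw [TensorHat.smul_mkLeft, hθ, hθ, mul_smul]) t
  have hθr : ∀ (a : A) t, θ (op a • t) = op (i a) • θ t := fun a t =>
    TensorHat.addHom_ext_left
      (f := θ.toLinearMap.toAddMonoidHom.comp (DistribSMul.toAddMonoidHom _ (op a)))
      (g := (DistribSMul.toAddMonoidHom _ (op (i a))).comp θ.toLinearMap.toAddMonoidHom)
      (θ.continuous.comp (continuous_const_smul (op a))) (θ.continuous.const_smul (op (i a)))
      (fun c m => by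
        change θ (op a • TensorHat.mkLeft i M c m) = op (i a) • θ (TensorHat.mkLeft i M c m)
        rw [TensorHat.op_smul_mkLeft, hθ, hθ, hjr, smul_comm]) t
  have hρl : ∀ (a : A) t, ρ (a • t) = i a • ρ t := fun a t =>
    TensorHat.addHom_ext_right (f := ρ.toLinearMap.toAddMonoidHom.comp (DistribSMul.toAddMonoidHom _ a))
      (g := (DistribSMul.toAddMonoidHom _ (i a)).comp ρ.toLinearMap.toAddMonoidHom)
      (ρ.continuous.comp (continuous_const_smul a)) (ρ.continuous.const_smul (i a))
      (fun m c => by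
        change ρ (a • TensorHat.mkRight i M m c) = i a • ρ (TensorHat.mkRight i M m c)
        rw [TensorHat.smul_mkRight, hρ, hρ, hjl, ← smul_comm (i a)]) t
  have hρr : ∀ (b : B) t, ρ (op b • t) = op b • ρ t := fun b t =>
    TensorHat.addHom_ext_right
      (f := ρ.toLinearMap.toAddMonoidHom.comp (DistribSMul.toAddMonoidHom _ (op b)))
      (g := (DistribSMul.toAddMonoidHom _ (op b)).comp ρ.toLinearMap.toAddMonoidHom)
      (ρ.continuous.comp (continuous_const_smul (op b))) (ρ.continuous.const_smul (op b))
      (fun m c => by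
        change ρ (op b • TensorHat.mkRight i M m c) = op b • ρ (TensorHat.mkRight i M m c)
        rw [TensorHat.op_smul_mkRight, hρ, hρ, ← mul_smul]
        rfl) t
  constructor
  -- The inverse of `θ` is the extension of `m ↦ 1 ⊗ m` to the envelope.
  · let f : M →L[ℂ] TensorHat A (AlongHom i B) M :=
      ⟨TensorHat.mkLeft i M 1,
        (TensorHat.continuous_mkLeft i).comp (f := fun m : M => ((1 : B), m)) (by fun_prop)⟩
    have hf : ∀ m, f m = TensorHat.mkLeft i M 1 m := fun _ => rfl
    obtain ⟨g, hgl, hgr, hg⟩ := hj.exists_lift_transport e hcomm f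
      (fun a m => by
        rw [hf, hf, ← TensorHat.mkLeft_balanced, TensorHat.smul_mkLeft, one_mul, mul_one])
      (fun a m => by rw [her', hf, hf, TensorHat.op_smul_mkLeft])
    refine ⟨ContinuousLinearEquiv.equivOfInverse θ g (fun t => ?_) fun x => ?_, hθ⟩
    · refine congrArg (fun f => f t) (TensorHat.hom_ext_left
        (f := g.comp θ) (g := ContinuousLinearMap.id ℂ _) fun b m => ?_)
      simp [hθ, hgl, hg, hf]
    · refine congrArg (fun f => f x) (hj.eq_id hi (θ.comp g) (fun a x => ?_) (fun a x => ?_)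
        fun m => ?_)
      · simp [hgl, hθl]
      · simp [hgr, her', hθr]
      · simp [hg, hf, hθ]
  -- Extending `m ↦ e (m ⊗ 1)` to the envelope and applying `e.symm` yields a right inverse of `ρ`.
  · let f : M →L[ℂ] TensorHat A (AlongHom i B) M := (e : _ →L[ℂ] _).comp
      ⟨(TensorHat.mkRight i M).flip 1,
        (TensorHat.continuous_mkRight i).comp (f := fun m : M => (m, (1 : B))) (by fun_prop)⟩
    have hf : ∀ m, f m = e (TensorHat.mkRight i M m 1) := fun _ => rfl
    obtain ⟨g, hgl, hgr, hg⟩ := hj.exists_lift_transport e hcomm f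
      (fun a m => by
        rw [hf, hf, ← TensorHat.smul_mkRight, hel, TensorHat.smul_eq_outer_smul])
      (fun a m => by
        rw [hf, hf, e.symm_apply_apply, TensorHat.mkRight_balanced, TensorHat.op_smul_mkRight,
          one_mul, mul_one])
    let h : MH →L[ℂ] MH := ρ.comp ((e.symm : _ →L[ℂ] _).comp g)
    have hh : ∀ x, h x = ρ (e.symm (g x)) := fun _ => rfl
    have hid := hj.eq_id hi h
      (fun a x => by
        rw [hh, hh, hgl, ← TensorHat.smul_eq_outer_smul, hel', hρl])
      (fun a x => by rw [hh, hh, hgr, e.symm_apply_apply, hρr])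
      (fun m => by rw [hh, hg, hf, e.symm_apply_apply, hρ, MulOpposite.op_one, one_smul])
    exact ⟨ρ, fun x => ⟨e.symm (g x), congrArg (fun f => f x) hid⟩, hρ⟩

end IsBimoduleArensMichaelEnvelope

end BimoduleEnvelope

/-! ### `M ⊗̂_A N` as a `⊗̂`-bimodule -/

section TensorHatBimoduleInstance

variable {A M N : Type*} [Ring A] [Algebra ℂ A] [UniformSpace A] [CompleteLCS A]
  [AddCommGroup M] [Module ℂ M] [UniformSpace M] [CompleteLCS M]
  [Module A M] [Module Aᵐᵒᵖ M] [TensorHatBimodule A M]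
  [AddCommGroup N] [Module ℂ N] [UniformSpace N] [CompleteLCS N]
  [Module A N] [Module Aᵐᵒᵖ N] [TensorHatBimodule A N]

namespace TensorHat

/-- An unbundled form of `TensorHat.addHom_ext`. -/
theorem eq_of_tmul {X : Type*} [AddCommGroup X] [TopologicalSpace X] [T2Space X]
    {f g : TensorHat A M N → X} (hf : Continuous f) (hg : Continuous g)
    (hf' : ∀ x y, f (x + y) = f x + f y) (hg' : ∀ x y, g (x + y) = g x + g y)
    (h : ∀ m n, f (tmul A m n) = g (tmul A m n)) (t : TensorHat A M N) : f t = g t :=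
  addHom_ext (f := AddMonoidHom.mk' f hf') (g := AddMonoidHom.mk' g hg') hf hg h t

instance : IsScalarTower ℂ A (TensorHat A M N) :=
  ⟨fun z a t => eq_of_tmul (f := fun t => (z • a) • t) (g := fun t => z • a • t)
    (continuous_const_smul _) ((continuous_const_smul a).const_smul z)
    (by simp) (by simp) (fun m n => by
      simp only [smul_tmul, smul_assoc]
      exact LinearMap.map_smul₂ (mk A M N) z _ _) t⟩

instance : IsScalarTower ℂ Aᵐᵒᵖ (TensorHat A M N) :=
  ⟨fun z a t => eq_of_tmul (f := fun t => (z • a) • t) (g := fun t => z • a • t)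
    (continuous_const_smul _) ((continuous_const_smul a).const_smul z)
    (by simp) (by simp) (fun m n => by
      change op ((z • a).unop) • tmul A m n = z • op a.unop • tmul A m n
      rw [op_smul_tmul, op_smul_tmul, MulOpposite.unop_smul, MulOpposite.op_smul, smul_assoc]
      exact map_smul (mk A M N m) z _) t⟩

instance : SMulCommClass A Aᵐᵒᵖ (TensorHat A M N) :=
  ⟨fun a b t => eq_of_tmul (f := fun t => a • b • t) (g := fun t => b • a • t)
    ((continuous_const_smul b).const_smul a) ((continuous_const_smul a).const_smul b)
    (by simp) (by simp) (fun m n => by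
      change a • op b.unop • tmul A m n = op b.unop • a • tmul A m n
      simp only [smul_tmul, op_smul_tmul]) t⟩

variable (A M N)

/-- The left action of `A` on `M ⊗̂_A N` as a linear map. -/
noncomputable def smulₗ : A →ₗ[ℂ] TensorHat A M N →L[ℂ] TensorHat A M N where
  toFun a :=
    { toFun := fun t => a • t
      map_add' := smul_add a
      map_smul' := fun z t => smul_comm a z t
      cont := continuous_const_smul a }
  map_add' a b := by ext t; exact add_smul a b t
  map_smul' z a := by ext t; exact smul_assoc z a t

/-- The right action of `A` on `M ⊗̂_A N` as a linear map. -/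
noncomputable def opSmulₗ : A →ₗ[ℂ] TensorHat A M N →L[ℂ] TensorHat A M N where
  toFun a :=
    { toFun := fun t => op a • t
      map_add' := smul_add (op a)
      map_smul' := fun z t => smul_comm (op a) z t
      cont := continuous_const_smul (op a) }
  map_add' a b := by ext t; exact add_smul (op a) (op b) t
  map_smul' z a := by ext t; exact smul_assoc z (op a) t

/-- Completion alone gives continuity of each single multiplication; joint continuity comes from
`continuous_uncurry`. Applied to the envelopes, it makes `b ↦ b • e` continuous for a fixed tensor
`e`. -/
instance : TensorHatBimodule A (TensorHat A M N) where
  isScalarTower_left := inferInstance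
  isScalarTower_right := inferInstance
  smulCommClass := inferInstance
  continuousSMul_left := ⟨continuous_uncurry (smulₗ A M N) (by
    have h : Continuous fun x : A × M × N => tmul A (x.1 • x.2.1) x.2.2 :=
      continuous_tmul.comp (f := fun x : A × M × N => (x.1 • x.2.1, x.2.2)) (by fun_prop)
    exact h.congr fun x => (smul_tmul A x.1 x.2.1 x.2.2).symm)⟩
  continuousSMul_right := ⟨by
    have h : Continuous fun x : A × TensorHat A M N => opSmulₗ A M N x.1 x.2 := by
      refine continuous_uncurry (opSmulₗ A M N) ?_
      have h : Continuous fun x : A × M × N => tmul A x.2.1 (op x.1 • x.2.2) :=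
        continuous_tmul.comp (f := fun x : A × M × N => (x.2.1, op x.1 • x.2.2)) (by fun_prop)
      exact h.congr fun x => (op_smul_tmul A x.1 x.2.1 x.2.2).symm
    have h' : Continuous fun x : Aᵐᵒᵖ × TensorHat A M N => opSmulₗ A M N x.1.unop x.2 :=
      h.comp (f := fun x : Aᵐᵒᵖ × TensorHat A M N => (x.1.unop, x.2)) (by fun_prop)
    exact h'⟩

end TensorHat

end TensorHatBimoduleInstance

/-! ### The pairing of the envelopes -/

section Pairing

variable {A B M N MH NH : Type u} [Ring A] [Algebra ℂ A] [UniformSpace A] [TensorHatAlgebra A]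
  [Ring B] [Algebra ℂ B] [UniformSpace B] [TensorHatAlgebra B] {i : A →A[ℂ] B}
  [AddCommGroup M] [Module ℂ M] [UniformSpace M] [CompleteLCS M]
  [Module A M] [Module Aᵐᵒᵖ M] [TensorHatBimodule A M]
  [AddCommGroup N] [Module ℂ N] [UniformSpace N] [CompleteLCS N]
  [Module A N] [Module Aᵐᵒᵖ N] [TensorHatBimodule A N]
  [AddCommGroup MH] [Module ℂ MH] [UniformSpace MH] [CompleteLCS MH]
  [Module B MH] [Module Bᵐᵒᵖ MH] [TensorHatBimodule B MH]
  [AddCommGroup NH] [Module ℂ NH] [UniformSpace NH] [CompleteLCS NH]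
  [Module B NH] [Module Bᵐᵒᵖ NH] [TensorHatBimodule B NH]
  {jM : M →L[ℂ] MH} {jN : N →L[ℂ] NH}

/-- Continuous additive maps that agree on all `b • j m` are equal, if `B ⊗̂_A M → MH` is onto. -/
theorem eq_of_smul_apply {j : M →L[ℂ] MH} (θ : TensorHat A (AlongHom i B) M →L[ℂ] MH)
    (hθ : Function.Surjective θ) (hθ' : ∀ b m, θ (TensorHat.mkLeft i M b m) = b • j m)
    {X : Type*} [AddCommGroup X] [TopologicalSpace X] [T2Space X] {f g : MH → X}
    (hf : Continuous f) (hg : Continuous g)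
    (hf' : ∀ x y, f (x + y) = f x + f y) (hg' : ∀ x y, g (x + y) = g x + g y)
    (h : ∀ (b : B) m, f (b • j m) = g (b • j m)) (x : MH) : f x = g x := by
  obtain ⟨t, rfl⟩ := hθ x
  refine TensorHat.addHom_ext_left (f := AddMonoidHom.mk' (fun t => f (θ t)) (by simp [hf']))
    (g := AddMonoidHom.mk' (fun t => g (θ t)) (by simp [hg'])) (hf.comp θ.continuous)
    (hg.comp θ.continuous) (fun b m => ?_) t
  simpa [hθ'] using h b m

/-- Continuous additive maps that agree on all `op b • j m` are equal, if `M ⊗̂_A B → MH` is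
onto. -/
theorem eq_of_op_smul_apply {j : M →L[ℂ] MH} (ρ : TensorHat A M (AlongHom i B) →L[ℂ] MH)
    (hρ : Function.Surjective ρ) (hρ' : ∀ m b, ρ (TensorHat.mkRight i M m b) = op b • j m)
    {X : Type*} [AddCommGroup X] [TopologicalSpace X] [T2Space X] {f g : MH → X}
    (hf : Continuous f) (hg : Continuous g)
    (hf' : ∀ x y, f (x + y) = f x + f y) (hg' : ∀ x y, g (x + y) = g x + g y)
    (h : ∀ (b : B) m, f (op b • j m) = g (op b • j m)) (x : MH) : f x = g x := by
  obtain ⟨t, rfl⟩ := hρ x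
  refine TensorHat.addHom_ext_right (f := AddMonoidHom.mk' (fun t => f (ρ t)) (by simp [hf']))
    (g := AddMonoidHom.mk' (fun t => g (ρ t)) (by simp [hg'])) (hf.comp ρ.continuous)
    (hg.comp ρ.continuous) (fun m b => ?_) t
  simpa [hρ'] using h b m

/-- A bimodule map `M ⊗̂_A N → A` induces a `B`-valued balanced pairing of the envelopes. -/
theorem exists_pairing (hi : IsTensorHatEpi i)
    (hjM : IsBimoduleMapAlong i jM) (hjN : IsBimoduleMapAlong i jN)
    (θM : TensorHat A (AlongHom i B) M ≃L[ℂ] MH)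
    (hθM : ∀ b m, θM (TensorHat.mkLeft i M b m) = b • jM m)
    (θN : TensorHat A (AlongHom i B) N ≃L[ℂ] NH)
    (hθN : ∀ b n, θN (TensorHat.mkLeft i N b n) = b • jN n)
    (k : TensorHat A M N →L[ℂ] A) (hk : IsBimoduleMap A k) :
    ∃ I : TensorHat B MH NH →L[ℂ] B, IsBimoduleMap B I ∧
      ∀ m n, I (TensorHat.tmul B (jM m) (jN n)) = i (k (TensorHat.tmul A m n)) := by
  obtain ⟨hkl, hkr⟩ := hk
  let p : M →ₗ[ℂ] N →ₗ[ℂ] B :=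
    (TensorHat.mk A M N).compr₂ (i.toAlgHom.toLinearMap ∘ₗ k.toLinearMap)
  have hp : ∀ m n, p m n = i (k (TensorHat.tmul A m n)) := fun _ _ => rfl
  have hpc : Continuous fun x : M × N => p x.1 x.2 :=
    i.continuous.comp (k.continuous.comp TensorHat.continuous_tmul)
  have hpl : ∀ a m n, p (a • m) n = i a * p m n := fun a m n => by
    rw [hp, hp, ← TensorHat.smul_tmul, hkl, id, smul_eq_mul, map_mul]
  have hpr : ∀ a m n, p m (op a • n) = p m n * i a := fun a m n => by
    rw [hp, hp, ← TensorHat.op_smul_tmul, hkr, id, op_smul_eq_mul, map_mul]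
  have hpb : ∀ m a n, p (op a • m) n = p m (a • n) := fun m a n => by
    rw [hp, hp, TensorHat.tmul_balanced]
  have hM := fun {f g : MH → B} => eq_of_smul_apply (i := i) (j := jM) (f := f) (g := g)
    (θM : TensorHat A (AlongHom i B) M →L[ℂ] MH) θM.surjective hθM
  have hN := fun {f g : NH → B} => eq_of_smul_apply (i := i) (j := jN) (f := f) (g := g)
    (θN : TensorHat A (AlongHom i B) N →L[ℂ] NH) θN.surjective hθN
  -- the pairing of `MH` with `N`
  have hFc : ∀ n, Continuous fun x : B × M => x.1 * p x.2 n := fun n =>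
    continuous_fst.mul (hpc.comp (f := fun x : B × M => (x.2, n)) (by fun_prop))
  let φ : N → B →ₗ[ℂ] M →ₗ[ℂ] B := fun n => (LinearMap.mul ℂ B).compl₂ (p.flip n)
  have hφ : ∀ n b m, φ n b m = b * p m n := fun _ _ _ => rfl
  have hφb : ∀ n b a m, φ n (b * i a) m = φ n b (a • m) := fun n b a m => by
    rw [hφ, hφ, hpl, mul_assoc]
  let F₀ : N → TensorHat A (AlongHom i B) M →L[ℂ] B := fun n =>
    TensorHat.liftLeft (φ n) (hφb n) (hFc n)
  have hF₀ : ∀ n b m, F₀ n (TensorHat.mkLeft i M b m) = b * p m n := fun n b m =>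
    TensorHat.liftLeft_mkLeft (φ n) (hφb n) (hFc n) b m
  let F : N →ₗ[ℂ] TensorHat A (AlongHom i B) M →L[ℂ] B :=
    { toFun := F₀
      map_add' := fun n n' => TensorHat.hom_ext_left fun b m => by
        rw [add_apply, hF₀, hF₀, hF₀, map_add, mul_add]
      map_smul' := fun z n => TensorHat.hom_ext_left fun b m => by
        rw [smul_apply, hF₀, hF₀, map_smul, mul_smul_comm]; rfl }
  have hF : ∀ n b m, F n (TensorHat.mkLeft i M b m) = b * p m n := hF₀
  have hFc' : Continuous fun x : N × TensorHat A (AlongHom i B) M => F x.1 x.2 := by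
    refine TensorHat.continuous_uncurry_left F ?_
    simp only [hF]
    exact (continuous_fst.comp continuous_snd).mul
      (hpc.comp (f := fun x : N × B × M => (x.2.2, x.1)) (by fun_prop))
  -- Transport along `B ⊗̂_A M ≃ MH` gives the pairing determined by `(b • jM m, n) ↦ b * p m n`.
  let γ : N →ₗ[ℂ] MH →L[ℂ] B :=
    { toFun := fun n => (F n).comp (θM.symm : MH →L[ℂ] TensorHat A (AlongHom i B) M)
      map_add' := fun n n' => by rw [map_add]; rfl
      map_smul' := fun z n => by rw [map_smul]; rfl }
  have hγ : ∀ n b m, γ n (b • jM m) = b * p m n := fun n b m => by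
    change F n (θM.symm (b • jM m)) = _
    rw [← hθM, θM.symm_apply_apply, hF]
  have hγc : Continuous fun x : N × MH => γ x.1 x.2 :=
    hFc'.comp (f := fun x : N × MH => (x.1, θM.symm x.2))
      (continuous_fst.prodMk (θM.symm.continuous.comp continuous_snd))
  have hγl : ∀ n (b : B) x, γ n (b • x) = b * γ n x := fun n b x =>
    hM (f := fun x => γ n (b • x)) (g := fun x => b * γ n x) (by fun_prop) (by fun_prop)
      (fun x y => by rw [smul_add, map_add]) (fun x y => by rw [map_add, mul_add])
      (fun c m => by rw [smul_smul, hγ, hγ, mul_assoc]) x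
  have hγb : ∀ a n x, γ (a • n) x = γ n (op (i a) • x) := fun a n x =>
    hM (f := fun x => γ (a • n) x) (g := fun x => γ n (op (i a) • x)) (by fun_prop) (by fun_prop)
      (fun x y => map_add _ x y) (fun x y => by rw [smul_add, map_add])
      (fun c m => by rw [← smul_comm c, ← hjM.2, hγ, hγ, hpb]) x
  have hγr : ∀ a n x, γ (op a • n) x = γ n x * i a := fun a n x =>
    hM (f := fun x => γ (op a • n) x) (g := fun x => γ n x * i a) (by fun_prop) (by fun_prop)
      (fun x y => map_add _ x y) (fun x y => by rw [map_add, add_mul])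
      (fun c m => by rw [hγ, hγ, hpr, mul_assoc]) x
  -- the pairing of `MH` with `NH`
  let ψ : MH → B →ₗ[ℂ] N →ₗ[ℂ] B := fun x => LinearMap.mk₂ ℂ (fun b n => γ n (op b • x))
    (fun b b' n => by rw [MulOpposite.op_add, add_smul, map_add])
    (fun z b n => by rw [MulOpposite.op_smul, smul_assoc, map_smul])
    (fun b n n' => by rw [map_add γ]; rfl) (fun z b n => by rw [map_smul γ]; rfl)
  have hψ : ∀ x b n, ψ x b n = γ n (op b • x) := fun _ _ _ => rfl
  -- The right `B`-action on `MH` absorbs the coefficient of `b • jN n`; balancedness over `A` is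
  -- then `hγb`.
  have hψb : ∀ x b a n, ψ x (b * i a) n = ψ x b (a • n) := fun x b a n => by
    rw [hψ, hψ, hγb, MulOpposite.op_mul, mul_smul]
  have hψc : ∀ x, Continuous fun y : B × N => ψ x y.1 y.2 := fun x =>
    hγc.comp (f := fun y : B × N => (y.2, op y.1 • x)) (by fun_prop)
  let G₀ : MH → TensorHat A (AlongHom i B) N →L[ℂ] B := fun x =>
    TensorHat.liftLeft (ψ x) (hψb x) (hψc x)
  have hG₀ : ∀ x b n, G₀ x (TensorHat.mkLeft i N b n) = γ n (op b • x) := fun x b n =>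
    TensorHat.liftLeft_mkLeft (ψ x) (hψb x) (hψc x) b n
  let G : MH →ₗ[ℂ] TensorHat A (AlongHom i B) N →L[ℂ] B :=
    { toFun := G₀
      map_add' := fun x x' => TensorHat.hom_ext_left fun b n => by
        rw [add_apply, hG₀, hG₀, hG₀, smul_add, map_add]
      map_smul' := fun z x => TensorHat.hom_ext_left fun b n => by
        rw [smul_apply, hG₀, hG₀, smul_comm (op b) z x]
        exact map_smul (γ n) z _ }
  have hG : ∀ x b n, G x (TensorHat.mkLeft i N b n) = γ n (op b • x) := hG₀
  have hGc : Continuous fun x : MH × TensorHat A (AlongHom i B) N => G x.1 x.2 := by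
    refine TensorHat.continuous_uncurry_left G ?_
    simp only [hG]
    exact hγc.comp (f := fun x : MH × B × N => (x.2.2, op x.2.1 • x.1)) (by fun_prop)
  let β : MH →ₗ[ℂ] NH →ₗ[ℂ] B := LinearMap.mk₂ ℂ (fun x y => G x (θN.symm y))
    (fun x x' y => by rw [map_add]; rfl) (fun z x y => by rw [map_smul]; rfl)
    (fun x y y' => by rw [map_add, map_add]) (fun z x y => by rw [map_smul, map_smul])
  have hβ : ∀ x (b : B) n, β x (b • jN n) = γ n (op b • x) := fun x b n => by
    change G x (θN.symm (b • jN n)) = _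
    rw [← hθN, θN.symm_apply_apply, hG]
  have hβc : Continuous fun x : MH × NH => β x.1 x.2 :=
    hGc.comp (f := fun x : MH × NH => (x.1, θN.symm x.2))
      (continuous_fst.prodMk (θN.symm.continuous.comp continuous_snd))
  have hβx : ∀ x, Continuous fun y => β x y := fun x =>
    hβc.comp (f := fun y => (x, y)) (by fun_prop)
  have hβb : ∀ x (c : B) y, β (op c • x) y = β x (c • y) := fun x c y =>
    hN (f := fun y => β (op c • x) y) (g := fun y => β x (c • y)) (hβx _)
      ((hβx x).comp (continuous_const_smul c)) (fun y y' => map_add _ y y')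
      (fun y y' => by rw [smul_add, map_add])
      (fun b n => by rw [smul_smul, hβ, hβ, MulOpposite.op_mul, mul_smul]) y
  have hβl : ∀ (c : B) x y, β (c • x) y = c * β x y := fun c x y =>
    hN (f := fun y => β (c • x) y) (g := fun y => c * β x y) (hβx _)
      (continuous_const.mul (hβx x)) (fun y y' => map_add _ y y')
      (fun y y' => by rw [map_add, mul_add])
      (fun b n => by rw [hβ, hβ, ← smul_comm c, hγl]) y
  -- On generators `b • jN n` only right multiplication by elements `i a` can be moved inside `jN`,
  -- so right `A`-linearity is checked and then upgraded to `B`.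
  have hβr : ∀ x (c : B) y, β x (op c • y) = β x y * c := fun x c y =>
    hi.map_op_smul (X := NH) (Y := B) ⟨β x, hβx x⟩ (fun a y =>
      hN (f := fun y => β x (op (i a) • y)) (g := fun y => β x y * i a)
        ((hβx x).comp (continuous_const_smul _)) ((hβx x).mul continuous_const)
        (fun y y' => by rw [smul_add, map_add]) (fun y y' => by rw [map_add, add_mul])
        (fun b n => by rw [← smul_comm b, ← hjN.2, hβ, hβ, hγr]) y) c y
  let I : TensorHat B MH NH →L[ℂ] B := TensorHat.lift β hβb hβc
  have hI : ∀ x y, I (TensorHat.tmul B x y) = β x y := TensorHat.lift_tmul β hβb hβc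
  refine ⟨I, ⟨fun b t => ?_, fun b t => ?_⟩, fun m n => ?_⟩
  · refine TensorHat.eq_of_tmul (f := fun t => I (b • t)) (g := fun t => b * I t)
      (I.continuous.comp (continuous_const_smul b)) (continuous_const.mul I.continuous)
      (fun s t => by rw [smul_add, map_add]) (fun s t => by rw [map_add, mul_add])
      (fun x y => by rw [TensorHat.smul_tmul, hI, hI, hβl]) t
  · refine TensorHat.eq_of_tmul (f := fun t => I (op b • t)) (g := fun t => I t * b)
      (I.continuous.comp (continuous_const_smul _)) (I.continuous.mul continuous_const)
      (fun s t => by rw [smul_add, map_add]) (fun s t => by rw [map_add, add_mul])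
      (fun x y => by rw [TensorHat.op_smul_tmul, hI, hI, hβr]) t
  · rw [hI, ← one_smul B (jN n), hβ, MulOpposite.op_one, one_smul, ← one_smul B (jM m), hγ,
      one_mul, hp]

/-- An isomorphism `M ⊗̂_A N ≃ A` of bimodules induces one `MH ⊗̂_B NH ≃ B` for the envelopes. -/
theorem exists_pairing_equiv (hi : IsTensorHatEpi i)
    (hjM : IsBimoduleMapAlong i jM) (hjN : IsBimoduleMapAlong i jN)
    (θM : TensorHat A (AlongHom i B) M ≃L[ℂ] MH)
    (hθM : ∀ b m, θM (TensorHat.mkLeft i M b m) = b • jM m)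
    (θN : TensorHat A (AlongHom i B) N ≃L[ℂ] NH)
    (hθN : ∀ b n, θN (TensorHat.mkLeft i N b n) = b • jN n)
    (k : TensorHat A M N ≃L[ℂ] A) (hk : IsBimoduleMap A k) :
    ∃ I : TensorHat B MH NH ≃L[ℂ] B, IsBimoduleMap B I ∧
      ∀ m n, I (TensorHat.tmul B (jM m) (jN n)) = i (k (TensorHat.tmul A m n)) := by
  obtain ⟨I, hIb, hI⟩ := exists_pairing hi hjM hjN θM hθM θN hθN (k : TensorHat A M N →L[ℂ] A) hk
  obtain ⟨hkl, hkr⟩ := hk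
  replace hkl : ∀ (a : A) t, k (a • t) = a * k t := hkl
  replace hkr : ∀ (a : A) t, k (op a • t) = k t * a := hkr
  have hIl : ∀ (b : B) t, I (b • t) = b * I t := hIb.1
  -- the map `M ⊗̂_A N → MH ⊗̂_B NH`
  let δ : M →ₗ[ℂ] N →ₗ[ℂ] TensorHat B MH NH :=
    (TensorHat.mk B MH NH).compl₁₂ jM.toLinearMap jN.toLinearMap
  have hδ : ∀ m n, δ m n = TensorHat.tmul B (jM m) (jN n) := fun _ _ => rfl
  have hδb : ∀ m (a : A) n, δ (op a • m) n = δ m (a • n) := fun m a n => by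
    rw [hδ, hδ, hjM.2, hjN.1, TensorHat.tmul_balanced]
  have hδc : Continuous fun x : M × N => δ x.1 x.2 :=
    TensorHat.continuous_tmul.comp (f := fun x : M × N => (jM x.1, jN x.2)) (by fun_prop)
  let D : TensorHat A M N →L[ℂ] TensorHat B MH NH := TensorHat.lift δ hδb hδc
  have hD : ∀ m n, D (TensorHat.tmul A m n) = TensorHat.tmul B (jM m) (jN n) :=
    TensorHat.lift_tmul δ hδb hδc
  have hDl : ∀ a t, D (a • t) = i a • D t := fun a t =>
    TensorHat.eq_of_tmul (f := fun t => D (a • t)) (g := fun t => i a • D t)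
      (D.continuous.comp (continuous_const_smul a)) ((continuous_const_smul (i a)).comp D.continuous)
      (fun s t => by rw [smul_add, map_add]) (fun s t => by rw [map_add, smul_add])
      (fun m n => by rw [TensorHat.smul_tmul, hD, hD, TensorHat.smul_tmul, hjM.1]) t
  have hDr : ∀ a t, D (op a • t) = op (i a) • D t := fun a t =>
    TensorHat.eq_of_tmul (f := fun t => D (op a • t)) (g := fun t => op (i a) • D t)
      (D.continuous.comp (continuous_const_smul _))
      ((continuous_const_smul (op (i a))).comp D.continuous)
      (fun s t => by rw [smul_add, map_add]) (fun s t => by rw [map_add, smul_add])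
      (fun m n => by rw [TensorHat.op_smul_tmul, hD, hD, TensorHat.op_smul_tmul, hjN.2]) t
  have hID : ∀ t, I (D t) = i (k t) := fun t =>
    TensorHat.eq_of_tmul (f := fun t => I (D t)) (g := fun t => i (k t))
      (I.continuous.comp D.continuous) (i.continuous.comp k.continuous)
      (by simp) (by simp) (fun m n => by rw [hD, hI]; rfl) t
  -- the canonical central element of `MH ⊗̂_B NH`
  set e : TensorHat B MH NH := D (k.symm 1) with he
  have hkl' : ∀ a, k.symm a = a • k.symm 1 := fun a => by
    rw [k.symm_apply_eq, hkl, k.apply_symm_apply, mul_one]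
  have hkr' : ∀ a, k.symm a = op a • k.symm 1 := fun a => by
    rw [k.symm_apply_eq, hkr, k.apply_symm_apply, one_mul]
  -- Since `k` is an isomorphism, every `t` is `k t • k.symm 1`, so `D` takes values in the
  -- multiples of `e`.
  have hDe : ∀ t, D t = i (k t) • e := fun t => by
    rw [he, ← hDl, ← hkl', k.symm_apply_apply]
  have hecent : ∀ b : B, b • e = op b • e := hi.central e fun a => by
    rw [he, ← hDl, ← hDr, ← hkl', ← hkr']
  have hIe : I e = 1 := by rw [he, hID, k.apply_symm_apply, map_one]
  let σ : B →L[ℂ] TensorHat B MH NH :=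
    { toFun := fun b => b • e
      map_add' := fun b c => add_smul b c e
      map_smul' := fun z b => smul_assoc z b e
      cont := by fun_prop }
  have hσ : ∀ b, σ b = b • e := fun _ => rfl
  have htc : ∀ y : NH, Continuous fun x : MH => TensorHat.tmul B x y := fun y =>
    TensorHat.continuous_tmul.comp (f := fun x : MH => (x, y)) (by fun_prop)
  have htc' : ∀ x : MH, Continuous fun y : NH => TensorHat.tmul B x y := fun x =>
    TensorHat.continuous_tmul.comp (f := fun y : NH => (x, y)) (by fun_prop)
  have hta : ∀ x x' (y : NH), TensorHat.tmul B (x + x') y =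
      TensorHat.tmul B x y + TensorHat.tmul B x' y := fun x x' y =>
    LinearMap.map_add₂ (TensorHat.mk B MH NH) x x' y
  have hta' : ∀ (x : MH) y y', TensorHat.tmul B x (y + y') =
      TensorHat.tmul B x y + TensorHat.tmul B x y' := fun x y y' =>
    map_add (TensorHat.mk B MH NH x) y y'
  -- For `x = b • jM m`, left linearity removes `b`, and the rest is `hDe` at `m ⊗ n`.
  have h1 : ∀ x n, σ (I (TensorHat.tmul B x (jN n))) = TensorHat.tmul B x (jN n) := fun x n =>
    eq_of_smul_apply (i := i) (j := jM) (θM : TensorHat A (AlongHom i B) M →L[ℂ] MH)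
      θM.surjective hθM (f := fun x => σ (I (TensorHat.tmul B x (jN n))))
      (g := fun x => TensorHat.tmul B x (jN n))
      (σ.continuous.comp (I.continuous.comp (htc _))) (htc _)
      (fun x x' => by rw [hta, map_add, map_add]) (fun x x' => hta x x' _)
      (fun b m => by
        rw [← TensorHat.smul_tmul, hIl, hσ, mul_smul, hI, ← hD, hDe]
        rfl) x
  -- For `y = b • jN n` the coefficient moves across the tensor sign onto the arbitrary `x` of `h1`.
  have h2 : ∀ x y, σ (I (TensorHat.tmul B x y)) = TensorHat.tmul B x y := fun x y =>
    eq_of_smul_apply (i := i) (j := jN) (θN : TensorHat A (AlongHom i B) N →L[ℂ] NH)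
      θN.surjective hθN (f := fun y => σ (I (TensorHat.tmul B x y)))
      (g := fun y => TensorHat.tmul B x y)
      (σ.continuous.comp (I.continuous.comp (htc' _))) (htc' _)
      (fun y y' => by rw [hta', map_add, map_add]) (fun y y' => hta' x y y')
      (fun b n => by rw [← TensorHat.tmul_balanced, h1]) y
  refine ⟨ContinuousLinearEquiv.equivOfInverse I σ (fun t => ?_) fun b => ?_, hIb, hI⟩
  · exact congrArg (fun f => f t) (TensorHat.hom_ext (f := σ.comp I)
      (g := ContinuousLinearMap.id ℂ _) h2)
  · rw [hσ, hIl, hIe, mul_one]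

/-- The associativity square of the pairings of the envelopes. -/
theorem pairing_assoc
    (θM : TensorHat A (AlongHom i B) M →L[ℂ] MH) (hθM : Function.Surjective θM)
    (hθM' : ∀ b m, θM (TensorHat.mkLeft i M b m) = b • jM m)
    (ρM : TensorHat A M (AlongHom i B) →L[ℂ] MH) (hρM : Function.Surjective ρM)
    (hρM' : ∀ m b, ρM (TensorHat.mkRight i M m b) = op b • jM m)
    (θN : TensorHat A (AlongHom i B) N →L[ℂ] NH) (hθN : Function.Surjective θN)
    (hθN' : ∀ b n, θN (TensorHat.mkLeft i N b n) = b • jN n)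
    (I : TensorHat B MH NH →L[ℂ] B) (hI : IsBimoduleMap B I)
    (J : TensorHat B NH MH →L[ℂ] B) (hJ : IsBimoduleMap B J)
    (h : ∀ m n m', I (TensorHat.tmul B (jM m) (jN n)) • jM m' =
      op (J (TensorHat.tmul B (jN n) (jM m'))) • jM m) (x : MH) (y : NH) (x' : MH) :
    I (TensorHat.tmul B x y) • x' = op (J (TensorHat.tmul B y x')) • x := by
  have hIl : ∀ (b : B) t, I (b • t) = b * I t := hI.1
  have hJl : ∀ (b : B) t, J (b • t) = b * J t := hJ.1
  have hJr : ∀ (b : B) t, J (op b • t) = J t * b := hJ.2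
  have hIc : Continuous fun z : MH × NH => I (TensorHat.tmul B z.1 z.2) :=
    I.continuous.comp TensorHat.continuous_tmul
  have hJc : Continuous fun z : NH × MH => J (TensorHat.tmul B z.1 z.2) :=
    J.continuous.comp TensorHat.continuous_tmul
  have hIx : ∀ y, Continuous fun x => I (TensorHat.tmul B x y) := fun y =>
    hIc.comp (f := fun x => (x, y)) (by fun_prop)
  have hIy : ∀ x, Continuous fun y => I (TensorHat.tmul B x y) := fun x =>
    hIc.comp (f := fun y => (x, y)) (by fun_prop)
  have hJx : ∀ y, Continuous fun x => J (TensorHat.tmul B x y) := fun y =>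
    hJc.comp (f := fun x => (x, y)) (by fun_prop)
  have hJy : ∀ x, Continuous fun y => J (TensorHat.tmul B x y) := fun x =>
    hJc.comp (f := fun y => (x, y)) (by fun_prop)
  have hIa : ∀ x x' y, I (TensorHat.tmul B (x + x') y) =
      I (TensorHat.tmul B x y) + I (TensorHat.tmul B x' y) := fun x x' y => by
    rw [← map_add]
    exact congrArg I (LinearMap.map_add₂ (TensorHat.mk B MH NH) x x' y)
  have hIa' : ∀ x y y', I (TensorHat.tmul B x (y + y')) =
      I (TensorHat.tmul B x y) + I (TensorHat.tmul B x y') := fun x y y' => by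
    rw [← map_add]
    exact congrArg I (map_add (TensorHat.mk B MH NH x) y y')
  have hJa : ∀ x x' y, J (TensorHat.tmul B (x + x') y) =
      J (TensorHat.tmul B x y) + J (TensorHat.tmul B x' y) := fun x x' y => by
    rw [← map_add]
    exact congrArg J (LinearMap.map_add₂ (TensorHat.mk B NH MH) x x' y)
  have hJa' : ∀ x y y', J (TensorHat.tmul B x (y + y')) =
      J (TensorHat.tmul B x y) + J (TensorHat.tmul B x y') := fun x y y' => by
    rw [← map_add]
    exact congrArg J (map_add (TensorHat.mk B NH MH x) y y')
  have hop : Continuous (op : B → Bᵐᵒᵖ) := MulOpposite.continuous_op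
  -- The variables are freed one at a time. A left coefficient of `x` factors out of both sides.
  have h1 : ∀ x n m', I (TensorHat.tmul B x (jN n)) • jM m' =
      op (J (TensorHat.tmul B (jN n) (jM m'))) • x := fun x n m' =>
    eq_of_smul_apply θM hθM hθM' (f := fun x => I (TensorHat.tmul B x (jN n)) • jM m')
      (g := fun x => op (J (TensorHat.tmul B (jN n) (jM m'))) • x)
      ((hIx _).smul continuous_const) (continuous_const_smul _)
      (fun x x' => by rw [hIa, add_smul]) (fun x x' => smul_add _ x x')
      (fun b m => by rw [← TensorHat.smul_tmul, hIl, mul_smul, h, smul_comm]) x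
  -- A left coefficient of `y` moves onto `x` inside `I` and factors out of `J` on the left.
  have h2 : ∀ x y m', I (TensorHat.tmul B x y) • jM m' =
      op (J (TensorHat.tmul B y (jM m'))) • x := fun x y m' =>
    eq_of_smul_apply θN hθN hθN' (f := fun y => I (TensorHat.tmul B x y) • jM m')
      (g := fun y => op (J (TensorHat.tmul B y (jM m'))) • x)
      ((hIy _).smul continuous_const) ((hop.comp (hJx _)).smul continuous_const)
      (fun y y' => by rw [hIa', add_smul])
      (fun y y' => by rw [hJa, MulOpposite.op_add, add_smul])
      (fun b n => by
        rw [← TensorHat.tmul_balanced, h1, ← TensorHat.smul_tmul, hJl, MulOpposite.op_mul,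
          mul_smul]) y
  -- For the last variable right coefficients are used: they factor out on the right of both sides,
  -- which is where surjectivity of `ρM` enters.
  exact eq_of_op_smul_apply ρM hρM hρM' (f := fun x' => I (TensorHat.tmul B x y) • x')
    (g := fun x' => op (J (TensorHat.tmul B y x')) • x)
    (continuous_const_smul _) ((hop.comp (hJy _)).smul continuous_const)
    (fun x x' => smul_add _ x x') (fun y y' => by rw [hJa', MulOpposite.op_add, add_smul])
    (fun b m' => by
      rw [smul_comm, h2, ← TensorHat.op_smul_tmul, hJr, MulOpposite.op_mul, mul_smul]) x'

end Pairing

theorem theorem2p1 {A AH M N MH NH : Type u}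
    [Ring A] [Algebra ℂ A] [UniformSpace A] [TensorHatAlgebra A]
    [Ring AH] [Algebra ℂ AH] [UniformSpace AH] [ArensMichaelAlgebra AH]
    [AddCommGroup M] [Module ℂ M] [UniformSpace M] [CompleteLCS M]
    [Module A M] [Module Aᵐᵒᵖ M] [TensorHatBimodule A M]
    [AddCommGroup N] [Module ℂ N] [UniformSpace N] [CompleteLCS N]
    [Module A N] [Module Aᵐᵒᵖ N] [TensorHatBimodule A N]
    [AddCommGroup MH] [Module ℂ MH] [UniformSpace MH] [CompleteLCS MH]
    [Module AH MH] [Module AHᵐᵒᵖ MH] [TensorHatBimodule AH MH]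
    [AddCommGroup NH] [Module ℂ NH] [UniformSpace NH] [CompleteLCS NH]
    [Module AH NH] [Module AHᵐᵒᵖ NH] [TensorHatBimodule AH NH]
    (i : A →A[ℂ] AH) (hi : IsArensMichaelEnvelope i)
    (jM : M →L[ℂ] MH) (hjM : IsBimoduleArensMichaelEnvelope i jM)
    (jN : N →L[ℂ] NH) (hjN : IsBimoduleArensMichaelEnvelope i jN)
    (hMN : AreTopInverse A M N)
    (hM : TopBimoduleIso A (TensorHat A M (AlongHom i AH)) (TensorHat A (AlongHom i AH) M))
    (hN : TopBimoduleIso A (TensorHat A N (AlongHom i AH)) (TensorHat A (AlongHom i AH) N)) :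
    (IsTensorHatEpi i ↔ MulIsTopIso i) ∧
      (IsTensorHatEpi i → AreTopInverse AH MH NH) := by
  refine ⟨isTensorHatEpi_iff_mulIsTopIso, fun hepi => ?_⟩
  obtain ⟨i₁, i₂, hi₁, hi₂, h₁, h₂⟩ := hMN
  obtain ⟨⟨θM, hθM⟩, ρM, hρM, hρM'⟩ := hjM.exists_equiv hepi hM
  obtain ⟨⟨θN, hθN⟩, ρN, hρN, hρN'⟩ := hjN.exists_equiv hepi hN
  obtain ⟨I, hI, hI'⟩ := exists_pairing_equiv hepi hjM.1 hjN.1 θM hθM θN hθN i₁ hi₁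
  obtain ⟨J, hJ, hJ'⟩ := exists_pairing_equiv hepi hjN.1 hjM.1 θN hθN θM hθM i₂ hi₂
  -- On the images of `M` and `N` the square for the envelopes is the image under `jM` of the
  -- original one.
  have hIJ : ∀ m n m', I (TensorHat.tmul AH (jM m) (jN n)) • jM m' =
      op (J (TensorHat.tmul AH (jN n) (jM m'))) • jM m := fun m n m' => by
    rw [hI', hJ', ← hjM.1.1, ← hjM.1.2, h₁]
  have hJI : ∀ n m n', J (TensorHat.tmul AH (jN n) (jM m)) • jN n' =
      op (I (TensorHat.tmul AH (jM m) (jN n'))) • jN n := fun n m n' => by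
    rw [hI', hJ', ← hjN.1.1, ← hjN.1.2, h₂]
  exact ⟨I, J, hI, hJ,
    pairing_assoc θM.toContinuousLinearMap θM.surjective hθM ρM hρM hρM'
      θN.toContinuousLinearMap θN.surjective hθN I.toContinuousLinearMap hI
      J.toContinuousLinearMap hJ hIJ,
    pairing_assoc θN.toContinuousLinearMap θN.surjective hθN ρN hρN hρN'
      θM.toContinuousLinearMap θM.surjective hθM J.toContinuousLinearMap hJ
      I.toContinuousLinearMap hI hJI⟩
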